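/- **Setting.** A user's type is $\theta=(\theta_1,\theta_2)\in\{0,1\}^2$ with $\theta_1,\theta_2$ independent Bernoulli$(p)$, $0<p\le 1$; the user clicks on ad $i$ if and only if $\theta_i=1$. Two advertisers have values per click $v_1,v_2$ drawn independently (and independently of $\theta$ and of the conversation) from a regular distribution $F$ over $[0,\overline v]$, that is, $F$ has a density $f$ which is positive on $(0,\overline v)$, and the virtual value $v-\frac{1-F(v)}{f(v)}$ is nondecreasing there. The conversation is a process $(X_t)_{t\in[0,\infty)}$ with values in some $\mathbb R^n$, on a measurable space $\Omega$ that carries a probability law $P^\theta$ for each $\theta$; it is observed by the auctioneer, whose filtration $(\mathcal F_t)$ is the one generated by $X$. For a stopping time $\tau\in[0,\infty]$ her beliefs are $\mu^i_\tau=\mathbb E[\theta_i\mid\mathcal F_\tau]$ (with $\mathcal F_\infty=\sigma(X_t:t\ge 0)$). It is assumed that $\mu_0^i=p=:\mu_0$ almost surely, and that the whole conversation reveals the type: there is a function $g$ on $\Omega$, measurable with respect to $\sigma(X_t:t\ge0)$, with $g=\theta$ $P^\theta$-almost surely for every $\theta$. The advertisers submit bids $b_1,b_2\ge 0$ before the conversation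 begins, and the auctioneer then chooses a stopping time $\tau$ at which she runs the announced auction, without reserve price and without discounting. The ad with the higher score $b_i\mu^i_\tau$ is displayed (ties are resolved by a fair coin). If $i$'s ad is displayed and $\theta_i=1$, advertiser $i$ pays $b_i$ in the first-price auction and $b_{-i}\mu^{-i}_\tau/\mu^i_\tau$ in the second-price auction; if $\theta_i=0$ he pays nothing. His payoff is $\theta_i$ times his value minus his payment if his ad is displayed, and $0$ otherwise. A policy (a choice of $\tau$ as a function of the bids) is optimal if, for every $(b_1,b_2)$, it maximizes the auctioneer's expected revenue over all stopping times. **Theorem.** 1. In the second-price auction the policy $\tau^*_{2P}=0$ is optimal, and under it truthful bidding is a dominant strategy. In the first-price auction the policy $\tau^*_{1P}=\infty$ is optimal, and under it there is a symmetric pure-strategy Bayes–Nash equilibrium. 2. Let $\pi_{2P}$ be the expected revenue of the second-price auction run at $\tau^*_{2P}=0$ under truthful bidding, and let $\pi_{1P}$ be the expected revenue of the first-price auction run at $\tau^*_{1P}=\infty$ in an arbitrary pure-strategy Bayes–Nash equilibrium $(\beta_1,\beta_2)$ (symmetric or not). Then $\pi_{1P}>0$, $$\pi_{1P}\le\pi_{2P},\qquad\text{and}\qquad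 \frac{\pi_{2P}}{\pi_{1P}}=\frac1{\mu_0}=\frac1p .$$ -/

import Mathlib

open MeasureTheory ProbabilityTheory
open scoped NNReal ENNReal

noncomputable section

/-- A user type `θ = (θ₁, θ₂)`: `θ i = true` means that ad `i` is of good quality, i.e. that the
user clicks on ad `i` when it is shown. -/
abbrev UserType : Type := Fin 2 → Bool

/-- The numerical quality `θ_i ∈ {0, 1}`. -/
def UserType.quality (θ : UserType) (i : Fin 2) : ℝ := if θ i then 1 else 0

/-- The two auction formats. -/
inductive AuctionFormat
  | firstPrice
  | secondPrice

/-- `i` displays his ad when his score is the highest; a tie is resolved by a fair coin.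
`winShare s i` is the probability with which ad `i` is shown when the scores are `s`
(`1 - i` is the opponent of `i`). -/
def winShare (s : Fin 2 → ℝ) (i : Fin 2) : ℝ :=
  if s (1 - i) < s i then 1 else if s (1 - i) = s i then 1 / 2 else 0

/-- Payment of advertiser `i` when his ad is shown and clicked, given the bids `b` and the
beliefs `μ` at the time of the auction: his own bid in a first-price auction, and
`b_{-i} μ^{-i} / μ^i` in a second-price auction. -/
def pricePerClick (fmt : AuctionFormat) (b μ : Fin 2 → ℝ) (i : Fin 2) : ℝ :=
  match fmt with
  | .firstPrice => b i
  | .secondPrice => b (1 - i) * μ (1 - i) / μ i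

/-- `F` is a regular value distribution over `[0, vbar]`: it has a density `f`, positive on
`(0, vbar)`, and a nondecreasing virtual value `v - (1 - F(v)) / f(v)`. -/
def IsRegularDistribution (F : Measure ℝ) (vbar : ℝ) : Prop :=
  0 < vbar ∧ ∃ f : ℝ → ℝ, Measurable f ∧ (∀ v ∈ Set.Ioo 0 vbar, 0 < f v) ∧
    F = (volume.restrict (Set.Icc 0 vbar)).withDensity (fun v => ENNReal.ofReal (f v)) ∧
    MonotoneOn (fun v => v - (1 - cdf F v) / f v) (Set.Ioo 0 vbar)

/-- The primitives of the conversation: the prior probability `p` of a good-quality ad, the law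
`P^θ` on the sample space `Ω` for each user type `θ`, and the observed process
`X_t : Ω → ℝⁿ`, `t ∈ [0, ∞)`. -/
structure Conversation (Ω : Type*) [MeasurableSpace Ω] where
  /-- prior probability that an ad is of good quality -/
  p : unitInterval
  /-- the laws `P^θ` -/
  law : Kernel UserType Ω
  isMarkov : IsMarkovKernel law
  /-- dimension of the observed process -/
  n : ℕ
  /-- the observed process -/
  X : ℝ≥0 → Ω → Fin n → ℝ
  measurable_X : ∀ t, Measurable (X t)

namespace Conversation

variable {Ω : Type*} [MeasurableSpace Ω] (M : Conversation Ω)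

instance : IsMarkovKernel M.law := M.isMarkov

/-- The prior on user types: the qualities are independent Bernoulli variables with
parameter `p`. -/
def prior : Measure UserType := Measure.pi fun _ => bernoulliMeasure true false M.p

/-- The joint law of the user type and the conversation. -/
def joint : Measure (UserType × Ω) := M.prior ⊗ₘ M.law

/-- The auctioneer's information: the natural filtration of the conversation. -/
def filtration : Filtration ℝ≥0 (inferInstance : MeasurableSpace (UserType × Ω)) :=
  Filtration.natural (fun t (s : UserType × Ω) => M.X t s.2)
    fun t => ((M.measurable_X t).comp measurable_snd).stronglyMeasurable

/-- The times in `[0, ∞]` at which the auctioneer can run the auction: the stopping times of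
her filtration. -/
def StopTime : Type _ :=
  {τ : UserType × Ω → WithTop ℝ≥0 // IsStoppingTime M.filtration τ}

/-- Stopping at time `0`. -/
def stopNow : M.StopTime :=
  ⟨fun _ => ((0 : ℝ≥0) : WithTop ℝ≥0), isStoppingTime_const M.filtration 0⟩

/-- Stopping at time `∞`. -/
def stopAtInfinity : M.StopTime := ⟨fun _ => ⊤, fun i => by simp⟩

/-- The belief `μ^i_τ = E[θ_i | 𝓕_τ]` about the quality of ad `i` at the stopping time `τ`
(for `τ = ∞` the σ-algebra `𝓕_τ` is the one generated by the whole conversation). -/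
def belief (τ : M.StopTime) (i : Fin 2) : UserType × Ω → ℝ :=
  condExp τ.2.measurableSpace M.joint fun s => s.1.quality i

/-- At the beginning of the conversation the beliefs are the prior: `μ^i_0 = p`. -/
def StartsAtPrior : Prop :=
  ∀ i, M.belief M.stopNow i =ᵐ[M.joint] fun _ => (M.p : ℝ)

/-- Identifiability: some function of the whole conversation recovers the user type, almost
surely under each `P^θ`. -/
def Identifiable : Prop :=
  ∃ g : Ω → UserType,
    Measurable[⨆ t, MeasurableSpace.comap (M.X t) inferInstance] g ∧
    ∀ θ, ∀ᵐ ω ∂(M.law θ), g ω = θ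

/-- The share of ad `i` in the auction run at time `τ` with bids `b`: bids are scored by the
beliefs, and the ad with the highest score `b_i μ^i_τ` is displayed. -/
def display (b : Fin 2 → ℝ) (τ : M.StopTime) (i : Fin 2) (s : UserType × Ω) : ℝ :=
  winShare (fun j => b j * M.belief τ j s) i

/-- The auctioneer's realized revenue: the displayed advertiser pays if his ad is clicked. -/
def revenueAt (fmt : AuctionFormat) (b : Fin 2 → ℝ) (τ : M.StopTime) (s : UserType × Ω) : ℝ :=
  ∑ i, M.display b τ i s * s.1.quality i * pricePerClick fmt b (fun j => M.belief τ j s) i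

/-- The realized payoff of advertiser `i` with value `v` per click. -/
def payoffAt (fmt : AuctionFormat) (b : Fin 2 → ℝ) (τ : M.StopTime) (i : Fin 2) (v : ℝ)
    (s : UserType × Ω) : ℝ :=
  M.display b τ i s * s.1.quality i * (v - pricePerClick fmt b (fun j => M.belief τ j s) i)

/-- An exercise policy chooses a stopping time after having seen the bids. -/
abbrev Policy : Type _ := (Fin 2 → ℝ) → M.StopTime

/-- Run the auction immediately, whatever the bids. -/
def immediate : M.Policy := fun _ => M.stopNow

/-- Delay the auction to infinity, whatever the bids. -/
def delayed : M.Policy := fun _ => M.stopAtInfinity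

/-- A policy is optimal if, for every profile of bids, it maximizes the auctioneer's expected
revenue over all stopping times. -/
def IsOptimalPolicy (fmt : AuctionFormat) (T : M.Policy) : Prop :=
  ∀ b : Fin 2 → ℝ, (∀ i, 0 ≤ b i) → ∀ σ : M.StopTime,
    ∫ s, M.revenueAt fmt b σ s ∂M.joint ≤ ∫ s, M.revenueAt fmt b (T b) s ∂M.joint

/-- Truthful bidding is a dominant strategy: against every opponent's bid, an advertiser with
value `v` can do no better, in expectation, than to bid `v`. -/
def IsTruthful (fmt : AuctionFormat) (T : M.Policy) (vbar : ℝ) : Prop :=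
  ∀ i, ∀ v ∈ Set.Icc 0 vbar, ∀ c : Fin 2 → ℝ, (∀ j, 0 ≤ c j) →
    ∫ s, M.payoffAt fmt c (T c) i v s ∂M.joint ≤
      ∫ s, M.payoffAt fmt (Function.update c i v) (T (Function.update c i v)) i v s ∂M.joint

/-- The bids when `i` bids `b` and his opponent, whose value is `w`, follows the bidding
function `β (1 - i)`. -/
def bidsAgainst (β : Fin 2 → ℝ → ℝ) (i : Fin 2) (b w : ℝ) : Fin 2 → ℝ :=
  Function.update (fun j => β j w) i b

/-- The expected payoff of advertiser `i` with value `v` who bids `b`, when his opponent's value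
is drawn from `F` (independently of the conversation) and his opponent bids according to `β`. -/
def interimPayoff (fmt : AuctionFormat) (T : M.Policy) (F : Measure ℝ) (β : Fin 2 → ℝ → ℝ)
    (i : Fin 2) (v b : ℝ) : ℝ :=
  ∫ x : (UserType × Ω) × ℝ,
    M.payoffAt fmt (bidsAgainst β i b x.2) (T (bidsAgainst β i b x.2)) i v x.1 ∂(M.joint.prod F)

/-- `β = (β₁, β₂)` is a Bayes–Nash equilibrium of the auction exercised according to `T`: every
type in `[0, vbar]` of each advertiser makes a nonnegative bid that is a best response among all
nonnegative bids. -/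
def IsEquilibrium (fmt : AuctionFormat) (T : M.Policy) (F : Measure ℝ) (vbar : ℝ)
    (β : Fin 2 → ℝ → ℝ) : Prop :=
  (∀ i, Measurable (β i)) ∧ (∀ i, ∀ v ∈ Set.Icc 0 vbar, 0 ≤ β i v) ∧
    ∀ i, ∀ v ∈ Set.Icc 0 vbar, ∀ b : ℝ, 0 ≤ b →
      M.interimPayoff fmt T F β i v b ≤ M.interimPayoff fmt T F β i v (β i v)

/-- The auctioneer's ex ante expected revenue, when the advertisers' values are drawn
independently from `F` (and independently of the conversation) and they bid according to `β`. -/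
def expectedRevenue (fmt : AuctionFormat) (T : M.Policy) (F : Measure ℝ)
    (β : Fin 2 → ℝ → ℝ) : ℝ :=
  ∫ x : (UserType × Ω) × (Fin 2 → ℝ),
    M.revenueAt fmt (fun i => β i (x.2 i)) (T fun i => β i (x.2 i)) x.1
      ∂(M.joint.prod (Measure.pi fun _ => F))

end Conversation

end

/-!
With exact beliefs (`τ = ∞`) an advertiser faces, in the first-price auction, a competitor who is
present with probability `p` only: a bid `b` of a bidder with value `v` yields
`p * (v - b) * winProb b`, where `winProb b` is the probability of beating an opponent whose bid
counts as `0` when his ad is bad.  With the prior as belief (`τ = 0`), the second-price auction is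
an ordinary one, played for a click that occurs with probability `p`.

*Optimal timing.*  First-price revenue never exceeds `max (b_i θ_i)` and equals it at `τ = ∞`.  In
the second-price auction the price is known at time `τ`, so it can be pulled out of the conditional
expectation; the expected revenue is then at most that of the lower score `b_i μ^i_τ`, which is at
most `p * min b₁ b₂` because the beliefs are martingales, and this is attained at `τ = 0`.

*Revenue.*  Any equilibrium `(α, β)` of the first-price auction, symmetric or not, is efficient.
Positive bids win with positive probability (`winProb_pos`), so bids are nondecreasing in the value
and below it (`IsBestReply.bounds`, `IsBestReply.monotone`).  By outbidding slightly the bid `β v`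
of the opponent with the same value, a bidder of value `v` wins at least with the efficient
probability `effProb v` (`IsBestReply.imitation`).  Multiplying the two inequalities so obtained
cancels the margins `v - α v` and `v - β v`: the product of the two winning probabilities is at
least `effProb v ^ 2`, and hence their sum at least `2 * effProb v`.  The average over `v` of the
sum of the winning probabilities does not depend on the bidding functions, so equality holds almost
everywhere (`IsBestReply.ae_winProb_eq`).  Winning probabilities are subgradients of the rents, so
the rents, and with them the payments, are those of the efficient allocation
(`IsBestReply.rent_eq`, `IsBestReply.mul_winProb_eq`): type `v` pays `p` times the competing value
that it beats on average.  Therefore the first-price revenue is `p ^ 2 E[min(v₁, v₂)]`, against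
`p E[min(v₁, v₂)]` for the second-price auction at `τ = 0`.

*Existence.*  The bid equal to the payment divided by the efficient winning probability is a
symmetric equilibrium (`isBestReply_eqBid`).
-/

noncomputable section

/-! ### The fair-coin tie-breaking rule -/

/-- The probability with which a score `x` wins against a score `y`. -/
def share (x y : ℝ) : ℝ := if y < x then 1 else if y = x then 1 / 2 else 0

lemma share_of_lt {x y : ℝ} (h : y < x) : share x y = 1 := by simp [share, h]

lemma share_of_gt {x y : ℝ} (h : x < y) : share x y = 0 := by
  simp [share, h.not_gt, h.ne']

lemma share_self (x : ℝ) : share x x = 1 / 2 := by simp [share]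

lemma share_nonneg (x y : ℝ) : 0 ≤ share x y := by
  unfold share; split_ifs <;> norm_num

lemma share_le_one (x y : ℝ) : share x y ≤ 1 := by
  unfold share; split_ifs <;> norm_num

lemma share_add_swap (x y : ℝ) : share x y + share y x = 1 := by
  rcases lt_trichotomy x y with h | rfl | h
  · simp [share_of_gt h, share_of_lt h]
  · rw [share_self]; norm_num
  · simp [share_of_gt h, share_of_lt h]

lemma share_mono_left {x x' : ℝ} (h : x ≤ x') (y : ℝ) : share x y ≤ share x' y := by
  unfold share; split_ifs <;> grind

lemma lt_of_share_eq_zero {x y : ℝ} (h : share x y = 0) : x < y := by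
  by_contra! h'
  rcases h'.lt_or_eq with h1 | rfl
  · simp [share_of_lt h1] at h
  · simp [share_self] at h

lemma share_mul_right {c : ℝ} (hc : 0 < c) (x y : ℝ) : share (x * c) (y * c) = share x y := by
  simp [share, mul_lt_mul_iff_left₀ hc, mul_left_inj' hc.ne']

lemma mul_share_add_swap_eq_max (x y : ℝ) : share x y * x + share y x * y = max x y := by
  rcases lt_trichotomy x y with h | rfl | h
  · simp [share_of_gt h, share_of_lt h, h.le]
  · rw [share_self, max_self]; ring
  · simp [share_of_gt h, share_of_lt h, h.le]

lemma mul_share_add_swap_eq_min (x y : ℝ) : share x y * y + share y x * x = min x y := by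
  rcases lt_trichotomy x y with h | rfl | h
  · simp [share_of_gt h, share_of_lt h, h.le]
  · rw [share_self, min_self]; ring
  · simp [share_of_gt h, share_of_lt h, h.le]

/-- Competing with the score `v` is optimal for whoever gains `v` and pays the competing score. -/
lemma share_mul_sub_le (t v w : ℝ) : share t w * (v - w) ≤ share v w * (v - w) := by
  rcases lt_trichotomy v w with h | rfl | h
  · simp only [share_of_gt h, zero_mul]
    nlinarith [share_nonneg t w]
  · simp
  · simp only [share_of_lt h, one_mul]
    nlinarith [share_le_one t w]

lemma measurable_share : Measurable fun q : ℝ × ℝ => share q.1 q.2 := by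
  unfold share
  refine Measurable.ite (measurableSet_lt measurable_snd measurable_fst) measurable_const ?_
  exact Measurable.ite (measurableSet_eq_fun measurable_snd measurable_fst) measurable_const
    measurable_const

lemma Measurable.share {α : Type*} {_ : MeasurableSpace α} {f g : α → ℝ} (hf : Measurable f)
    (hg : Measurable g) : Measurable fun a => share (f a) (g a) :=
  measurable_share.comp (hf.prodMk hg)

lemma integrable_share {α : Type*} [MeasurableSpace α] {P : Measure α} [IsFiniteMeasure P]
    {f g : α → ℝ} (hf : Measurable f) (hg : Measurable g) :
    Integrable (fun a => share (f a) (g a)) P :=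
  Integrable.of_bound (hf.share hg).aestronglyMeasurable 1
    (.of_forall fun a => by
      rw [Real.norm_of_nonneg (share_nonneg _ _)]; exact share_le_one _ _)

lemma integrable_share_left (P : Measure ℝ) [IsFiniteMeasure P] (v : ℝ) :
    Integrable (fun w => share v w) P :=
  integrable_share measurable_const measurable_id

/-! ### First-price auction with random participation -/

/-- The probability with which the bid `b` wins against an opponent whose value is drawn from `F`,
who bids according to `β`, and whose bid counts as `0` with probability `1 - p`. -/
def winProb (p : ℝ) (F : Measure ℝ) (β : ℝ → ℝ) (b : ℝ) : ℝ :=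
  (1 - p) * share b 0 + p * ∫ w, share b (β w) ∂F

/-- The bidding function `α` is, for every value in `[0, vbar]`, a nonnegative best reply
to the bidding function `β` in the first-price auction. -/
def IsBestReply (p : ℝ) (F : Measure ℝ) (vbar : ℝ) (α β : ℝ → ℝ) : Prop :=
  ∀ v ∈ Set.Icc 0 vbar, 0 ≤ α v ∧
    ∀ b, 0 ≤ b → (v - b) * winProb p F β b ≤ (v - α v) * winProb p F β (α v)

/-- `F` has no atoms, is concentrated on `(0, vbar)`, and charges every subinterval. -/
structure IsSpread (F : Measure ℝ) (vbar : ℝ) : Prop where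
  pos : 0 < vbar
  noAtoms : NullSingletonClass F
  ae_mem : ∀ᵐ v ∂F, v ∈ Set.Ioo 0 vbar
  charges : ∀ a c, 0 ≤ a → a < c → c ≤ vbar → 0 < F (Set.Ioo a c)

/-- The probability of winning in the efficient allocation, for a bidder with value `v`. -/
def effProb (p : ℝ) (F : Measure ℝ) (v : ℝ) : ℝ := 1 - p + p * ∫ w, share v w ∂F

/-- The information rent of a bidder with value `v` in the efficient allocation. -/
def effRent (p : ℝ) (F : Measure ℝ) (v : ℝ) : ℝ :=
  (1 - p) * v + p * ∫ w, share v w * (v - w) ∂F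

/-- The expected competing value that a bidder with value `v` beats, when the opponent
participates. -/
def beatenValue (F : Measure ℝ) (v : ℝ) : ℝ := ∫ w, share v w * w ∂F

/-- The symmetric equilibrium bid: the expected competing value, given that it is beaten (where
the value of an absent competitor counts as `0`). For `v = 0` and `p = 1` the denominator vanishes,
and `0 / 0 = 0` is the right value. -/
def eqBid (p : ℝ) (F : Measure ℝ) (v : ℝ) : ℝ := p * beatenValue F v / effProb p F v

section Core

variable {p : ℝ} {F : Measure ℝ} {vbar : ℝ} {α β : ℝ → ℝ}

lemma integral_share_nonneg (b : ℝ) (β : ℝ → ℝ) : 0 ≤ ∫ w, share b (β w) ∂F :=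
  integral_nonneg fun _ => share_nonneg _ _

lemma IsSpread.exists_mem_of_ae (hF : IsSpread F vbar) {P : ℝ → Prop} (hP : ∀ᵐ v ∂F, P v)
    {a c : ℝ} (ha : 0 ≤ a) (hac : a < c) (hc : c ≤ vbar) : ∃ v ∈ Set.Ioo a c, P v := by
  by_contra! h
  refine (hF.charges a c ha hac hc).ne' (measure_mono_null (fun v hv => ?_) hP)
  exact h v hv

lemma winProb_nonneg (hp0 : 0 < p) (hp1 : p ≤ 1) (β : ℝ → ℝ) (b : ℝ) :
    0 ≤ winProb p F β b := by
  have := integral_share_nonneg (F := F) b β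
  have := share_nonneg b 0
  have : 0 ≤ 1 - p := by linarith
  unfold winProb; positivity

/-- A type who bids more than the value never wins: bidding `0` would avoid any loss. -/
lemma IsBestReply.winProb_eq_zero (hp0 : 0 < p) (hp1 : p ≤ 1) (h : IsBestReply p F vbar α β)
    {v : ℝ} (hv : v ∈ Set.Icc 0 vbar) (hlt : v < α v) : winProb p F β (α v) = 0 := by
  have h1 := (h v hv).2 0 le_rfl
  have h2 := winProb_nonneg (F := F) hp0 hp1 β 0
  have h3 := winProb_nonneg (F := F) hp0 hp1 β (α v)
  nlinarith [mul_nonneg hv.1 h2]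

/-- The winning probability of a best reply is a subgradient of the equilibrium rent. -/
lemma IsBestReply.subgradient (h1 : IsBestReply p F vbar α β) {v v' : ℝ}
    (hv : v ∈ Set.Icc 0 vbar) (hv' : v' ∈ Set.Icc 0 vbar) :
    winProb p F β (α v) * (v' - v) ≤
      (v' - α v') * winProb p F β (α v') - (v - α v) * winProb p F β (α v) := by
  have := (h1 v' hv').2 (α v) (h1 v hv).1
  linarith

lemma IsBestReply.winProb_monotone (h1 : IsBestReply p F vbar α β) {v v' : ℝ}
    (hv : v ∈ Set.Icc 0 vbar) (hv' : v' ∈ Set.Icc 0 vbar) (h : v < v') :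
    winProb p F β (α v) ≤ winProb p F β (α v') := by
  have a := h1.subgradient hv hv'
  have b := h1.subgradient hv' hv
  nlinarith

lemma winProb_id_eq_effProb {v : ℝ} (hv : 0 < v) : winProb p F id v = effProb p F v := by
  simp [winProb, effProb, share_of_lt hv]

lemma effProb_nonneg (hp0 : 0 < p) (hp1 : p ≤ 1) (v : ℝ) : 0 ≤ effProb p F v := by
  have := integral_share_nonneg (F := F) v id
  have h1 : 0 ≤ 1 - p := by linarith
  exact add_nonneg h1 (mul_nonneg hp0.le this)

lemma effRent_nonneg (hp0 : 0 < p) (hp1 : p ≤ 1) {v : ℝ} (hv : 0 ≤ v) : 0 ≤ effRent p F v := by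
  have : 0 ≤ ∫ w, share v w * (v - w) ∂F := by
    refine integral_nonneg fun w => ?_
    rcases le_or_gt w v with h | h
    · exact mul_nonneg (share_nonneg _ _) (sub_nonneg.2 h)
    · simp [share_of_gt h]
  have : 0 ≤ 1 - p := by linarith
  unfold effRent; positivity

lemma beatenValue_nonneg (hF : IsSpread F vbar) (v : ℝ) : 0 ≤ beatenValue F v := by
  refine integral_nonneg_of_ae ?_
  filter_upwards [hF.ae_mem] with w hw using mul_nonneg (share_nonneg _ _) hw.1.le

lemma beatenValue_zero (hF : IsSpread F vbar) : beatenValue F 0 = 0 := by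
  refine integral_eq_zero_of_ae ?_
  filter_upwards [hF.ae_mem] with w hw
  simp [share_of_gt hw.1]

lemma eqBid_zero (hF : IsSpread F vbar) : eqBid p F 0 = 0 := by
  simp [eqBid, beatenValue_zero hF]

lemma eqBid_nonneg (hp0 : 0 < p) (hp1 : p ≤ 1) (hF : IsSpread F vbar) (v : ℝ) :
    0 ≤ eqBid p F v :=
  div_nonneg (mul_nonneg hp0.le (beatenValue_nonneg hF v)) (effProb_nonneg hp0 hp1 v)

variable [IsProbabilityMeasure F]

lemma winProb_mono (hp0 : 0 < p) (hp1 : p ≤ 1) (hβ : Measurable β) :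
    Monotone (winProb p F β) := by
  intro b b' h
  have h1 : ∫ w, share b (β w) ∂F ≤ ∫ w, share b' (β w) ∂F :=
    integral_mono (integrable_share measurable_const hβ) (integrable_share measurable_const hβ)
      fun w => share_mono_left h _
  have h2 := share_mono_left h 0
  have : 0 ≤ 1 - p := by linarith
  unfold winProb; gcongr

lemma measurable_integral_share (hβ : Measurable β) :
    Measurable fun b => ∫ w, share b (β w) ∂F :=
  (StronglyMeasurable.integral_prod_right (f := fun b w => share b (β w))
    ((measurable_fst.share (hβ.comp measurable_snd)).stronglyMeasurable)).measurable

lemma measurable_winProb (hβ : Measurable β) : Measurable (winProb p F β) :=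
  ((measurable_id.share measurable_const).const_mul _).add
    ((measurable_integral_share hβ).const_mul _)

lemma winProb_le_one (hp0 : 0 < p) (hp1 : p ≤ 1) (hβ : Measurable β) (b : ℝ) :
    winProb p F β b ≤ 1 := by
  have h1 : ∫ w, share b (β w) ∂F ≤ ∫ _, (1 : ℝ) ∂F :=
    integral_mono (integrable_share measurable_const hβ) (integrable_const _)
      fun w => share_le_one _ _
  simp only [integral_const, probReal_univ, smul_eq_mul, mul_one] at h1
  have h2 := share_le_one b 0
  unfold winProb
  nlinarith

lemma integrable_winProb (hp0 : 0 < p) (hp1 : p ≤ 1) (hα : Measurable α) (hβ : Measurable β) :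
    Integrable (fun v => winProb p F β (α v)) F :=
  Integrable.of_bound ((measurable_winProb hβ).comp hα).aestronglyMeasurable 1
    (.of_forall fun a => by
      rw [Real.norm_of_nonneg (winProb_nonneg hp0 hp1 _ _)]
      exact winProb_le_one hp0 hp1 hβ _)

/-- A bid that never wins is outbid almost surely. -/
lemma ae_lt_of_winProb_eq_zero (hp0 : 0 < p) (hp1 : p ≤ 1) (hβ : Measurable β) {b : ℝ}
    (h : winProb p F β b = 0) : ∀ᵐ w ∂F, b < β w := by
  have h1 := integral_share_nonneg (F := F) b β
  have h2 := share_nonneg b 0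
  have h3 : ∫ w, share b (β w) ∂F = 0 := by
    unfold winProb at h
    nlinarith [mul_nonneg (sub_nonneg.2 hp1) h2]
  rw [integral_eq_zero_iff_of_nonneg (Pi.le_def.2 fun w => share_nonneg b (β w))
    (integrable_share measurable_const hβ)] at h3
  filter_upwards [h3] with w hw
  exact lt_of_share_eq_zero hw

/-- In equilibrium every positive bid wins with positive probability. Otherwise all low types of
both bidders would overbid, hence would have to lose for sure, but the highest of two low-type
bids wins against the other. -/
lemma winProb_pos (hp0 : 0 < p) (hp1 : p ≤ 1) (hF : IsSpread F vbar) (hα : Measurable α)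
    (hβ : Measurable β) (h1 : IsBestReply p F vbar α β) (h2 : IsBestReply p F vbar β α)
    {b : ℝ} (hb : 0 < b) : 0 < winProb p F β b := by
  refine (winProb_nonneg hp0 hp1 β b).lt_of_ne' fun h0 => ?_
  have hc0 : 0 < min b vbar := lt_min hb hF.pos
  have hmem : ∀ v ∈ Set.Ioo 0 (min b vbar), v ∈ Set.Icc 0 vbar ∧ v < b := fun v hv =>
    ⟨⟨hv.1.le, hv.2.le.trans (min_le_right _ _)⟩, hv.2.trans_le (min_le_left _ _)⟩
  have hb1 := ae_lt_of_winProb_eq_zero hp0 hp1 hβ h0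
  -- the low types are those below `b`; `key1`: the low types of `β` overbid, hence never win
  have key1 : ∀ᵐ w ∂F, w ∈ Set.Ioo 0 (min b vbar) → winProb p F α (β w) = 0 ∧ b < β w := by
    filter_upwards [hb1] with w hw hwV
    exact ⟨h2.winProb_eq_zero hp0 hp1 (hmem w hwV).1 ((hmem w hwV).2.trans hw), hw⟩
  obtain ⟨w0, hw0, hw0'⟩ := hF.exists_mem_of_ae key1 le_rfl hc0 (min_le_right _ _)
  obtain ⟨hz, hbw⟩ := hw0' hw0
  have hb2 := ae_lt_of_winProb_eq_zero hp0 hp1 hα hz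
  -- hence the low types of `α` overbid as well, and never win against `β`
  have A : ∀ᵐ v ∂F, ∀ᵐ w ∂F, v ∈ Set.Ioo 0 (min b vbar) → α v < β w := by
    filter_upwards [hb2] with v hv
    by_cases hvV : v ∈ Set.Ioo 0 (min b vbar)
    · have := h1.winProb_eq_zero hp0 hp1 (hmem v hvV).1 ((hmem v hvV).2.trans (hbw.trans hv))
      filter_upwards [ae_lt_of_winProb_eq_zero hp0 hp1 hβ this] with w hw _ using hw
    · exact .of_forall fun w hh => absurd hh hvV
  have B : ∀ᵐ w ∂F, ∀ᵐ v ∂F, w ∈ Set.Ioo 0 (min b vbar) → β w < α v := by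
    filter_upwards [key1] with w hw
    by_cases hwV : w ∈ Set.Ioo 0 (min b vbar)
    · filter_upwards [ae_lt_of_winProb_eq_zero hp0 hp1 hα (hw hwV).1] with v hv _ using hv
    · exact .of_forall fun w hh => absurd hh hwV
  have hmeas : MeasurableSet {x : ℝ × ℝ | x.1 ∈ Set.Ioo 0 (min b vbar) → β x.1 < α x.2} := by
    have : {x : ℝ × ℝ | x.1 ∈ Set.Ioo 0 (min b vbar) → β x.1 < α x.2} =
        (Prod.fst ⁻¹' Set.Ioo 0 (min b vbar))ᶜ ∪ {x | β x.1 < α x.2} := by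
      ext x; simp only [Set.mem_ofPred_eq, Set.mem_union, Set.mem_compl_iff, Set.mem_preimage]
      tauto
    rw [this]
    exact (measurable_fst measurableSet_Ioo).compl.union
      (measurableSet_lt (hβ.comp measurable_fst) (hα.comp measurable_snd))
  have B' := (Measure.ae_ae_comm hmeas).1 B
  obtain ⟨v, hv, hvA, hvB⟩ := hF.exists_mem_of_ae (A.and B') le_rfl hc0 (min_le_right _ _)
  obtain ⟨w, hw, hwA, hwB⟩ := hF.exists_mem_of_ae (hvA.and hvB) le_rfl hc0 (min_le_right _ _)
  exact lt_asymm (hwA hv) (hwB hw)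

lemma IsBestReply.rent_pos (hp0 : 0 < p) (hp1 : p ≤ 1) (hF : IsSpread F vbar) (hα : Measurable α)
    (hβ : Measurable β) (h1 : IsBestReply p F vbar α β) (h2 : IsBestReply p F vbar β α)
    {v : ℝ} (hv : v ∈ Set.Ioc 0 vbar) : 0 < (v - α v) * winProb p F β (α v) := by
  have hv0 : 0 < v / 2 := half_pos hv.1
  have := (h1 v ⟨hv.1.le, hv.2⟩).2 (v / 2) hv0.le
  have := mul_pos hv0 (winProb_pos hp0 hp1 hF hα hβ h1 h2 hv0)
  linarith

/-- The bid `0` wins at best ties, so any positive bid at least doubles its winning probability. -/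
lemma two_mul_winProb_zero_le (hp0 : 0 < p) (hF : IsSpread F vbar)
    (hβ : Measurable β) (hβ0 : ∀ v ∈ Set.Icc 0 vbar, 0 ≤ β v) {b : ℝ} (hb : 0 < b) :
    2 * winProb p F β 0 ≤ winProb p F β b := by
  have h1 : ∫ w, 2 * share 0 (β w) ∂F ≤ ∫ w, share b (β w) ∂F := by
    refine integral_mono_ae ((integrable_share measurable_const hβ).const_mul _)
      (integrable_share measurable_const hβ) ?_
    filter_upwards [hF.ae_mem] with w hw
    rcases (hβ0 w (Set.Ioo_subset_Icc_self hw)).lt_or_eq with h | h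
    · simpa [share_of_gt h] using share_nonneg _ _
    · simp [← h, share_self, share_of_lt hb]
  rw [integral_const_mul] at h1
  unfold winProb
  rw [share_self, share_of_lt hb]
  nlinarith

/-- In equilibrium, types with a positive value win with positive probability, bid a positive
amount, and bid less than their value. -/
lemma IsBestReply.bounds (hp0 : 0 < p) (hp1 : p ≤ 1) (hF : IsSpread F vbar) (hα : Measurable α)
    (hβ : Measurable β) (h1 : IsBestReply p F vbar α β) (h2 : IsBestReply p F vbar β α)
    {v : ℝ} (hv : v ∈ Set.Ioc 0 vbar) :
    0 < winProb p F β (α v) ∧ 0 < α v ∧ α v < v := by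
  have hU := h1.rent_pos hp0 hp1 hF hα hβ h2 hv
  have hq : 0 < winProb p F β (α v) :=
    (winProb_nonneg hp0 hp1 _ _).lt_of_ne' fun h => by simp [h] at hU
  have hv' : v ∈ Set.Icc 0 vbar := ⟨hv.1.le, hv.2⟩
  refine ⟨hq, (h1 v hv').1.lt_of_ne' fun h => ?_, ?_⟩
  -- if `α v = 0`, then the bid `v / 4` wins twice as often with three quarters of the margin
  · rw [h] at hq
    have h3 := (h1 v hv').2 (v / 4) (by linarith [hv.1])
    have h4 := two_mul_winProb_zero_le hp0 hF hβ (fun v hv => (h2 v hv).1)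
      (b := v / 4) (by linarith [hv.1])
    rw [h] at h3
    nlinarith [mul_pos hv.1 hq, hv.1]
  · linarith [(pos_iff_pos_of_mul_pos hU).2 hq]

lemma IsBestReply.monotone (hp0 : 0 < p) (hp1 : p ≤ 1) (hF : IsSpread F vbar) (hα : Measurable α)
    (hβ : Measurable β) (h1 : IsBestReply p F vbar α β) (h2 : IsBestReply p F vbar β α)
    {v v' : ℝ} (hv : 0 < v) (h : v ≤ v') (hv' : v' ≤ vbar) : α v ≤ α v' := by
  rcases h.lt_or_eq with h | rfl
  swap
  · rfl
  -- a lower bid by the higher type would win as often, so the lower type would use it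
  by_contra! hlt
  have m := h1.winProb_monotone (v := v) (v' := v') ⟨hv.le, h.le.trans hv'⟩
    ⟨hv.le.trans h.le, hv'⟩ h
  have m' := winProb_mono (F := F) hp0 hp1 hβ hlt.le
  have e := m.antisymm m'
  have b := (h1 v ⟨hv.le, h.le.trans hv'⟩).2 (α v') (h1 v' ⟨hv.le.trans h.le, hv'⟩).1
  have q := (h1.bounds hp0 hp1 hF hα hβ h2 ⟨hv, h.le.trans hv'⟩).1
  rw [← e] at b
  nlinarith

/-! ### The efficient allocation -/

lemma continuous_effProb (hF : IsSpread F vbar) : Continuous (effProb p F) := by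
  have := hF.noAtoms
  refine continuous_const.add (continuous_const.mul (continuous_iff_continuousAt.2 fun v => ?_))
  refine continuousAt_of_dominated (bound := fun _ => 1) (.of_forall fun x =>
      (measurable_const.share measurable_id).aestronglyMeasurable) ?_ (integrable_const _) ?_
  · refine .of_forall fun x => .of_forall fun w => ?_
    rw [Real.norm_of_nonneg (share_nonneg _ _)]; exact share_le_one _ _
  · filter_upwards [Measure.ae_ne F v] with w hw
    rcases hw.lt_or_gt with h | h
    · refine continuousAt_const.congr (f := fun _ => (1 : ℝ)) ?_
      filter_upwards [lt_mem_nhds h] with x hx using (share_of_lt hx).symm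
    · refine continuousAt_const.congr (f := fun _ => (0 : ℝ)) ?_
      filter_upwards [gt_mem_nhds h] with x hx using (share_of_gt hx).symm

lemma effProb_strictMono (hp0 : 0 < p) (hF : IsSpread F vbar) {t v : ℝ} (ht : 0 ≤ t) (h : t < v)
    (hv : v ≤ vbar) : effProb p F t < effProb p F v := by
  have i1 := integrable_share_left F t
  have i2 := integrable_share_left F v
  suffices ∫ w, share t w ∂F < ∫ w, share v w ∂F by
    unfold effProb; gcongr
  refine (integral_mono i1 i2 fun w => share_mono_left h.le w).lt_of_ne fun e => ?_
  have e2 : ∫ w, (share v w - share t w) ∂F = 0 := by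
    rw [integral_sub i2 i1]; exact sub_eq_zero.2 e.symm
  rw [integral_eq_zero_iff_of_nonneg (Pi.le_def.2 fun w => sub_nonneg.2 (share_mono_left h.le w))
    (i2.sub i1)] at e2
  obtain ⟨w, hw, hw'⟩ := hF.exists_mem_of_ae e2 ht h hv
  simp [share_of_lt hw.2, share_of_gt hw.1] at hw'

lemma effProb_pos (hp0 : 0 < p) (hp1 : p ≤ 1) (hF : IsSpread F vbar) {v : ℝ}
    (hv : v ∈ Set.Ioc 0 vbar) : 0 < effProb p F v :=
  (effProb_nonneg hp0 hp1 0).trans_lt (effProb_strictMono hp0 hF le_rfl hv.1 hv.2)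

lemma integrable_share_mul_id (hF : IsSpread F vbar) (v : ℝ) :
    Integrable (fun w => share v w * w) F := by
  refine Integrable.of_bound
    ((measurable_const.share measurable_id).mul measurable_id).aestronglyMeasurable vbar ?_
  filter_upwards [hF.ae_mem] with w hw
  rw [Real.norm_of_nonneg (mul_nonneg (share_nonneg _ _) hw.1.le)]
  nlinarith [share_le_one v w, hw.1, hw.2]

lemma integrable_share_mul_sub (hF : IsSpread F vbar) (v x : ℝ) :
    Integrable (fun w => share v w * (x - w)) F := by
  have := ((integrable_share_left F v).mul_const x).sub
    (integrable_share_mul_id hF v)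
  refine this.congr (.of_forall fun w => ?_)
  simp only [Pi.sub_apply]; ring

/-- The payoff of a type with value `x` who wins like the type `v` and pays `p` times the competing
value that it beats. -/
lemma mul_effProb_sub (hF : IsSpread F vbar) (v x : ℝ) :
    x * effProb p F v - p * beatenValue F v = (1 - p) * x + p * ∫ w, share v w * (x - w) ∂F := by
  have : ∫ w, share v w * (x - w) ∂F = x * ∫ w, share v w ∂F - beatenValue F v := by
    unfold beatenValue
    rw [← integral_const_mul, ← integral_sub
      ((integrable_share_left F v).const_mul x)
      (integrable_share_mul_id hF v)]
    refine integral_congr_ae (.of_forall fun w => ?_)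
    ring
  rw [this]; unfold effProb; ring

lemma effRent_eq (hF : IsSpread F vbar) (v : ℝ) :
    effRent p F v = v * effProb p F v - p * beatenValue F v := (mul_effProb_sub hF v v).symm

/-- No type gains by mimicking another one in the efficient allocation. -/
lemma le_effRent (hp0 : 0 < p) (hF : IsSpread F vbar) (t v : ℝ) :
    v * effProb p F t - p * beatenValue F t ≤ effRent p F v := by
  rw [mul_effProb_sub hF]
  unfold effRent
  have : ∫ w, share t w * (v - w) ∂F ≤ ∫ w, share v w * (v - w) ∂F := by
    refine integral_mono (integrable_share_mul_sub hF _ _) (integrable_share_mul_sub hF _ _) ?_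
    exact fun w => share_mul_sub_le t v w
  gcongr

lemma effRent_subgradient (hp0 : 0 < p) (hF : IsSpread F vbar) (v v' : ℝ) :
    effProb p F v * (v' - v) ≤ effRent p F v' - effRent p F v := by
  have := le_effRent hp0 hF v v'
  rw [effRent_eq hF v]; linarith

lemma measurable_beatenValue : Measurable (beatenValue F) :=
  (StronglyMeasurable.integral_prod_right (f := fun b w => share b w * w)
    ((measurable_share.mul measurable_snd).stronglyMeasurable)).measurable

lemma measurable_effProb : Measurable (effProb p F) :=
  ((measurable_integral_share measurable_id).const_mul _).const_add _

/-! ### Equilibria of the first-price auction are efficient -/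

lemma effProb_le_one (hp0 : 0 < p) (v : ℝ) : effProb p F v ≤ 1 := by
  have h1 : ∫ w, share v w ∂F ≤ ∫ _, (1 : ℝ) ∂F :=
    integral_mono (integrable_share_left F v) (integrable_const _) fun w => share_le_one _ _
  simp only [integral_const, probReal_univ, smul_eq_mul, mul_one] at h1
  unfold effProb
  nlinarith

/-- A bidder can imitate the opponent: outbidding the opponent's bid for the value `v` by an
arbitrarily small amount beats all the opponent's types below `v`. -/
lemma IsBestReply.imitation (hp0 : 0 < p) (hp1 : p ≤ 1) (hF : IsSpread F vbar) (hα : Measurable α)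
    (hβ : Measurable β) (h1 : IsBestReply p F vbar α β) (h2 : IsBestReply p F vbar β α)
    {v : ℝ} (hv : v ∈ Set.Ioc 0 vbar) :
    (v - β v) * effProb p F v ≤ (v - α v) * winProb p F β (α v) := by
  have hb := h2.bounds hp0 hp1 hF hβ hα h1 hv
  have key : ∀ ε > 0, effProb p F v ≤ winProb p F β (β v + ε) := by
    intro ε hε
    have : ∫ w, share v w ∂F ≤ ∫ w, share (β v + ε) (β w) ∂F := by
      refine integral_mono_ae (integrable_share_left F v) (integrable_share measurable_const hβ) ?_
      filter_upwards [hF.ae_mem] with w hw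
      rcases le_or_gt w v with h | h
      · have := h2.monotone hp0 hp1 hF hβ hα h1 hw.1 h hv.2
        rw [share_of_lt (x := β v + ε) (by linarith)]
        exact share_le_one _ _
      · rw [share_of_gt h]
        exact share_nonneg _ _
    unfold effProb winProb
    rw [share_of_lt (by linarith [hb.2.1])]
    nlinarith
  by_contra! hlt
  -- bidding `ε ≤ d / 2` more costs at most `ε`, as probabilities are `≤ 1`, so that a profit of
  -- at least half the gap `d` is left
  set d := (v - β v) * effProb p F v - (v - α v) * winProb p F β (α v) with hd
  have hd0 : 0 < d := sub_pos.2 hlt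
  obtain ⟨ε, hε0, hε⟩ : ∃ ε > 0, ε ≤ d / 2 ∧ ε ≤ v - β v :=
    ⟨min (d / 2) (v - β v), lt_min (by linarith) (by linarith [hb.2.2]), min_le_left _ _,
      min_le_right _ _⟩
  have a := (h1 v ⟨hv.1.le, hv.2⟩).2 (β v + ε) (by linarith [hb.2.1])
  have b := mul_le_mul_of_nonneg_left (key ε hε0) (sub_nonneg.2 hε.2)
  have c := effProb_le_one (F := F) hp0 v
  nlinarith

/-- Whatever the (positive) bids, the two winning probabilities have a constant sum on average. -/
lemma integral_winProb_add_swap (hα : Measurable α) (hβ : Measurable β)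
    (hα0 : ∀ᵐ v ∂F, 0 < α v) (hβ0 : ∀ᵐ v ∂F, 0 < β v) :
    ∫ v, winProb p F β (α v) ∂F + ∫ v, winProb p F α (β v) ∂F = 2 * (1 - p) + p := by
  have expand : ∀ {γ δ : ℝ → ℝ}, Measurable γ → Measurable δ → (∀ᵐ v ∂F, 0 < γ v) →
      ∫ v, winProb p F δ (γ v) ∂F = (1 - p) + p * ∫ v, ∫ w, share (γ v) (δ w) ∂F ∂F := by
    intro γ δ hγ hδ h
    have i : Integrable (fun v => ∫ w, share (γ v) (δ w) ∂F) F :=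
      (integrable_share (P := F.prod F) (hγ.comp measurable_fst)
        (hδ.comp measurable_snd)).integral_prod_left
    have e : ∫ v, winProb p F δ (γ v) ∂F =
        ∫ v, ((1 - p) + p * ∫ w, share (γ v) (δ w) ∂F) ∂F := by
      refine integral_congr_ae ?_
      filter_upwards [h] with v hv
      simp [winProb, share_of_lt hv]
    rw [e, integral_add (integrable_const _) (i.const_mul _), integral_const_mul]
    simp
  have i1 : Integrable (fun x : ℝ × ℝ => share (α x.1) (β x.2)) (F.prod F) :=
    integrable_share (hα.comp measurable_fst) (hβ.comp measurable_snd)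
  have i2 : Integrable (fun x : ℝ × ℝ => share (β x.2) (α x.1)) (F.prod F) :=
    integrable_share (hβ.comp measurable_snd) (hα.comp measurable_fst)
  have sw : ∫ w, ∫ v, share (β w) (α v) ∂F ∂F = ∫ v, ∫ w, share (β w) (α v) ∂F ∂F :=
    (integral_integral_swap (f := fun v w => share (β w) (α v)) i2).symm
  have tot : ∫ v, ∫ w, share (α v) (β w) ∂F ∂F + ∫ v, ∫ w, share (β w) (α v) ∂F ∂F = 1 := by
    rw [← integral_integral_add i1 i2]
    simp [share_add_swap]
  rw [expand hα hβ hα0, expand hβ hα hβ0, sw]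
  linear_combination p * tot

/-- Almost all types win with the efficient probability. Imitation makes the product of the two
winning probabilities at least the square of the efficient one, hence their sum at least twice the
efficient one; but on average the sums agree. -/
lemma IsBestReply.ae_winProb_eq (hp0 : 0 < p) (hp1 : p ≤ 1) (hF : IsSpread F vbar)
    (hα : Measurable α) (hβ : Measurable β) (h1 : IsBestReply p F vbar α β)
    (h2 : IsBestReply p F vbar β α) : ∀ᵐ v ∂F, winProb p F β (α v) = effProb p F v := by
  have hprod : ∀ v ∈ Set.Ioo 0 vbar,
      effProb p F v ^ 2 ≤ winProb p F β (α v) * winProb p F α (β v) := by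
    intro v hv
    have hv' := Set.Ioo_subset_Ioc_self hv
    obtain ⟨qa, -, a⟩ := h1.bounds hp0 hp1 hF hα hβ h2 hv'
    obtain ⟨qb, -, b⟩ := h2.bounds hp0 hp1 hF hβ hα h1 hv'
    have m := mul_le_mul (h1.imitation hp0 hp1 hF hα hβ h2 hv')
      (h2.imitation hp0 hp1 hF hβ hα h1 hv')
      (mul_nonneg (by linarith) (effProb_nonneg hp0 hp1 v)) (mul_nonneg (by linarith) qa.le)
    have hpos : 0 < (v - α v) * (v - β v) := mul_pos (by linarith) (by linarith)
    refine le_of_mul_le_mul_left ?_ hpos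
    linarith
  have hsum : ∀ v ∈ Set.Ioo 0 vbar,
      0 ≤ winProb p F β (α v) + winProb p F α (β v) - 2 * effProb p F v := by
    intro v hv
    have h := hprod v hv
    have qa := winProb_nonneg (F := F) hp0 hp1 β (α v)
    have qb := winProb_nonneg (F := F) hp0 hp1 α (β v)
    have := effProb_nonneg (F := F) hp0 hp1 v
    have : 2 * effProb p F v ≤ winProb p F β (α v) + winProb p F α (β v) := by
      refine abs_le_of_sq_le_sq' ?_ (by positivity) |>.2
      nlinarith [sq_nonneg (winProb p F β (α v) - winProb p F α (β v))]
    linarith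
  have ia := integrable_winProb (F := F) hp0 hp1 hα hβ
  have ib := integrable_winProb (F := F) hp0 hp1 hβ hα
  have posid : ∀ᵐ v ∂F, 0 < id v := by filter_upwards [hF.ae_mem] with v hv using hv.1
  have ieff : (fun v => winProb p F id (id v)) =ᵐ[F] effProb p F := by
    filter_upwards [hF.ae_mem] with v hv using winProb_id_eq_effProb hv.1
  have ie : Integrable (effProb p F) F :=
    (integrable_winProb hp0 hp1 measurable_id measurable_id).congr ieff
  have iab : Integrable (fun v => winProb p F β (α v) + winProb p F α (β v)) F := ia.add ib
  have i3 : Integrable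
      (fun v => winProb p F β (α v) + winProb p F α (β v) - 2 * effProb p F v) F :=
    iab.sub (ie.const_mul 2)
  have e0 : ∫ v, (winProb p F β (α v) + winProb p F α (β v) - 2 * effProb p F v) ∂F = 0 := by
    have s1 := integral_winProb_add_swap (p := p) (F := F) hα hβ
      (by filter_upwards [hF.ae_mem] with v hv
          exact (h1.bounds hp0 hp1 hF hα hβ h2 (Set.Ioo_subset_Ioc_self hv)).2.1)
      (by filter_upwards [hF.ae_mem] with v hv
          exact (h2.bounds hp0 hp1 hF hβ hα h1 (Set.Ioo_subset_Ioc_self hv)).2.1)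
    have s2 := integral_winProb_add_swap (p := p) (F := F) measurable_id measurable_id posid posid
    rw [integral_congr_ae ieff] at s2
    rw [integral_sub iab (ie.const_mul 2), integral_add ia ib, integral_const_mul]
    linarith
  rw [integral_eq_zero_iff_of_nonneg_ae
    (by filter_upwards [hF.ae_mem] with v hv using hsum v hv)
    i3] at e0
  filter_upwards [e0, hF.ae_mem] with v hv hm
  have h := hprod v hm
  simp only [Pi.zero_apply] at hv
  have : (winProb p F β (α v) - winProb p F α (β v)) ^ 2 = 0 := by
    refine le_antisymm ?_ (sq_nonneg _)
    have e : effProb p F v = (winProb p F β (α v) + winProb p F α (β v)) / 2 := by linarith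
    rw [e] at h
    linarith
  have := pow_eq_zero_iff (two_ne_zero) |>.1 this
  linarith

/-- The almost everywhere equality holds at all interior types, as winning probabilities are
monotone, `effProb` is continuous, and `F` charges every interval. -/
lemma IsBestReply.winProb_eq (hp0 : 0 < p) (hp1 : p ≤ 1) (hF : IsSpread F vbar)
    (hα : Measurable α) (hβ : Measurable β) (h1 : IsBestReply p F vbar α β)
    (h2 : IsBestReply p F vbar β α) {v : ℝ} (hv : v ∈ Set.Ioo 0 vbar) :
    winProb p F β (α v) = effProb p F v := by
  have hae := h1.ae_winProb_eq hp0 hp1 hF hα hβ h2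
  have hc := (continuous_effProb (p := p) hF).continuousAt (x := v)
  refine le_antisymm ?_ ?_ <;> by_contra! hlt
  · obtain ⟨u, hu, hsub⟩ := mem_nhdsGE_iff_exists_Ico_subset' (hv.2) |>.1
      (mem_nhdsWithin_of_mem_nhds (hc (gt_mem_nhds hlt)))
    obtain ⟨t, ht, e⟩ := hF.exists_mem_of_ae hae hv.1.le (lt_min hu hv.2) (min_le_right _ _)
    have ht' := hsub ⟨ht.1.le, ht.2.trans_le (min_le_left _ _)⟩
    have := h1.winProb_monotone (Set.Ioo_subset_Icc_self hv)
      ⟨hv.1.le.trans ht.1.le, ht.2.le.trans (min_le_right _ _)⟩ ht.1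
    rw [e] at this
    exact (this.trans_lt ht').false
  · obtain ⟨u, hu, hsub⟩ := mem_nhdsLE_iff_exists_Ioc_subset' (hv.1) |>.1
      (mem_nhdsWithin_of_mem_nhds (hc (lt_mem_nhds hlt)))
    obtain ⟨t, ht, e⟩ := hF.exists_mem_of_ae hae (le_max_right u 0) (max_lt hu hv.1) hv.2.le
    have ht' := hsub ⟨(le_max_left _ _).trans_lt ht.1, ht.2.le⟩
    have := h1.winProb_monotone ⟨(le_max_right u 0).trans ht.1.le, ht.2.le.trans hv.2.le⟩
      (Set.Ioo_subset_Icc_self hv) ht.2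
    rw [e] at this
    exact (this.trans_lt ht').false

/-- A function whose increments are dominated, to second order, by those of another function `H`
is constant: subdivide the interval into `n` equal pieces and let `n → ∞`. -/
lemma eq_of_abs_sub_le_sub_mul_sub {D H : ℝ → ℝ} {a c : ℝ} (hac : a ≤ c)
    (h : ∀ x y, a ≤ x → x ≤ y → y ≤ c → |D y - D x| ≤ (H y - H x) * (y - x)) : D c = D a := by
  have bound : ∀ n : ℕ, 0 < n → |D c - D a| ≤ (H c - H a) * (c - a) / n := by
    intro n hn
    have hn' : (0 : ℝ) < n := by exact_mod_cast hn
    set x : ℕ → ℝ := fun k => a + k * ((c - a) / n) with hx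
    have hstep : 0 ≤ (c - a) / n := div_nonneg (sub_nonneg.2 hac) hn'.le
    have hx0 : x 0 = a := by simp [hx]
    have hxn : x n = c := by simp only [hx]; field_simp; ring
    have hd : ∀ k, x (k + 1) - x k = (c - a) / n := fun k => by simp only [hx]; push_cast; ring
    have hlow : ∀ k, a ≤ x k := fun k => by
      have : 0 ≤ (k : ℝ) * ((c - a) / n) := by positivity
      simp only [hx]; linarith
    have hmono : Monotone x := monotone_nat_of_le_succ fun k => by linarith [hd k]
    calc |D c - D a| = |∑ k ∈ Finset.range n, (D (x (k + 1)) - D (x k))| := by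
          rw [Finset.sum_range_sub (fun k => D (x k)), hx0, hxn]
      _ ≤ ∑ k ∈ Finset.range n, |D (x (k + 1)) - D (x k)| := Finset.abs_sum_le_sum_abs _ _
      _ ≤ ∑ k ∈ Finset.range n, (H (x (k + 1)) - H (x k)) * ((c - a) / n) := by
          refine Finset.sum_le_sum fun k hk => ?_
          rw [← hd k]
          exact h _ _ (hlow k) (hmono k.le_succ)
            ((hmono (Finset.mem_range.1 hk)).trans_eq hxn)
      _ = (H c - H a) * (c - a) / n := by
          rw [← Finset.sum_mul, Finset.sum_range_sub (fun k => H (x k)), hx0, hxn]; ring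
  have lim : Filter.Tendsto (fun n : ℕ => (H c - H a) * (c - a) / n) Filter.atTop (nhds 0) :=
    tendsto_const_div_atTop_nhds_zero_nat _
  have := ge_of_tendsto lim (Filter.eventually_atTop.2 ⟨1, fun n hn => bound n hn⟩)
  exact sub_eq_zero.1 (abs_nonpos_iff.1 this)

/-- Payoff equivalence: in equilibrium all interior types get the rent of the efficient
allocation. -/
lemma IsBestReply.rent_eq (hp0 : 0 < p) (hp1 : p ≤ 1) (hF : IsSpread F vbar)
    (hα : Measurable α) (hβ : Measurable β) (h1 : IsBestReply p F vbar α β)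
    (h2 : IsBestReply p F vbar β α) {v : ℝ} (hv : v ∈ Set.Ioo 0 vbar) :
    (v - α v) * winProb p F β (α v) = effRent p F v := by
  set D : ℝ → ℝ := fun v => (v - α v) * winProb p F β (α v) - effRent p F v with hD
  have inc : ∀ x y, 0 < x → x ≤ y → y < vbar →
      |D y - D x| ≤ (effProb p F y - effProb p F x) * (y - x) := by
    intro x y hx hxy hy
    have mx : x ∈ Set.Ioo 0 vbar := ⟨hx, hxy.trans_lt hy⟩
    have my : y ∈ Set.Ioo 0 vbar := ⟨hx.trans_le hxy, hy⟩
    have a := h1.subgradient (Set.Ioo_subset_Icc_self mx) (Set.Ioo_subset_Icc_self my)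
    have b := h1.subgradient (Set.Ioo_subset_Icc_self my) (Set.Ioo_subset_Icc_self mx)
    rw [h1.winProb_eq hp0 hp1 hF hα hβ h2 mx, h1.winProb_eq hp0 hp1 hF hα hβ h2 my] at a b
    have c := effRent_subgradient hp0 hF x y
    have d := effRent_subgradient hp0 hF y x
    simp only [hD]
    rw [h1.winProb_eq hp0 hp1 hF hα hβ h2 mx, h1.winProb_eq hp0 hp1 hF hα hβ h2 my, abs_le]
    constructor <;> nlinarith
  -- both rents vanish at `0`
  have small : ∀ x ∈ Set.Ioo 0 vbar, |D x| ≤ x := by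
    intro x hx
    obtain ⟨q0, a0, a1⟩ := h1.bounds hp0 hp1 hF hα hβ h2 (Set.Ioo_subset_Ioc_self hx)
    have q1 := winProb_le_one (F := F) hp0 hp1 hβ (α x)
    have r0 := effRent_nonneg (F := F) hp0 hp1 hx.1.le
    have r1 : effRent p F x ≤ x := by
      rw [effRent_eq hF]
      nlinarith [effProb_le_one (F := F) hp0 x, beatenValue_nonneg hF x, hx.1]
    have u0 : 0 ≤ (x - α x) * winProb p F β (α x) := mul_nonneg (by linarith) q0.le
    have u1 : (x - α x) * winProb p F β (α x) ≤ x := by nlinarith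
    simp only [hD, abs_le]
    constructor <;> linarith
  have hsmall : ∀ ε, 0 < ε → |D v| ≤ ε := by
    intro ε hε
    have hm : 0 < min ε v := lt_min hε hv.1
    have e := eq_of_abs_sub_le_sub_mul_sub (D := D) (min_le_right ε v) fun x y hx hxy hy =>
      inc x y (hm.trans_le hx) hxy (hy.trans_lt hv.2)
    rw [e]
    exact (small _ ⟨hm, (min_le_right _ _).trans_lt hv.2⟩).trans (min_le_left _ _)
  have := le_of_forall_pos_le_add (a := |D v|) (b := 0) fun ε hε => by simpa using hsmall ε hε
  exact sub_eq_zero.1 (abs_nonpos_iff.1 this)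

/-- Revenue equivalence: the expected payment of a type is the expected competing value that it
beats in the efficient allocation. -/
lemma IsBestReply.mul_winProb_eq (hp0 : 0 < p) (hp1 : p ≤ 1) (hF : IsSpread F vbar)
    (hα : Measurable α) (hβ : Measurable β) (h1 : IsBestReply p F vbar α β)
    (h2 : IsBestReply p F vbar β α) {v : ℝ} (hv : v ∈ Set.Ioo 0 vbar) :
    α v * winProb p F β (α v) = p * beatenValue F v := by
  have e := h1.rent_eq hp0 hp1 hF hα hβ h2 hv
  rw [effRent_eq hF, h1.winProb_eq hp0 hp1 hF hα hβ h2 hv] at e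
  rw [h1.winProb_eq hp0 hp1 hF hα hβ h2 hv]
  linarith

/-! ### Existence of a symmetric equilibrium -/

lemma eqBid_mul_effProb (hp0 : 0 < p) (hp1 : p ≤ 1) (hF : IsSpread F vbar) {v : ℝ}
    (hv : v ∈ Set.Icc 0 vbar) : eqBid p F v * effProb p F v = p * beatenValue F v := by
  rcases hv.1.lt_or_eq with h | rfl
  · exact div_mul_cancel₀ _ (effProb_pos hp0 hp1 hF ⟨h, hv.2⟩).ne'
  · simp [eqBid_zero hF, beatenValue_zero hF]

lemma effRent_pos (hp0 : 0 < p) (hp1 : p ≤ 1) (hF : IsSpread F vbar) {v : ℝ}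
    (hv : v ∈ Set.Ioc 0 vbar) : 0 < effRent p F v := by
  have h0 : 0 < v / 2 := half_pos hv.1
  have a := effRent_subgradient hp0 hF (v / 2) v
  have b := effRent_nonneg (F := F) hp0 hp1 h0.le
  have c := effProb_pos hp0 hp1 hF (v := v / 2) ⟨h0, by linarith [hv.1, hv.2]⟩
  nlinarith

/-- With `U = effRent` and `G = effProb`, the bid is `v - U v / G v`, and the subgradient inequality
for `U` gives the claim since `U t > 0` and `G t < G v`. -/
lemma eqBid_strictMono (hp0 : 0 < p) (hp1 : p ≤ 1) (hF : IsSpread F vbar) {t v : ℝ}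
    (ht : 0 < t) (htv : t < v) (hv : v ≤ vbar) : eqBid p F t < eqBid p F v := by
  have ht' : t ∈ Set.Ioc 0 vbar := ⟨ht, htv.le.trans hv⟩
  have Ht := effProb_pos hp0 hp1 hF ht'
  have Hlt := effProb_strictMono hp0 hF ht.le htv hv
  have U := effRent_pos hp0 hp1 hF ht'
  have s := effRent_subgradient hp0 hF v t
  rw [eqBid, eqBid, div_lt_div_iff₀ Ht (Ht.trans Hlt)]
  have e1 := effRent_eq (p := p) hF t
  have e2 := effRent_eq (p := p) hF v
  have m : t * effProb p F v - effRent p F t ≤ p * beatenValue F v := by linarith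
  calc p * beatenValue F t * effProb p F v
      = t * effProb p F t * effProb p F v - effRent p F t * effProb p F v := by rw [e1]; ring
    _ < t * effProb p F t * effProb p F v - effRent p F t * effProb p F t := by gcongr
    _ = (t * effProb p F v - effRent p F t) * effProb p F t := by ring
    _ ≤ p * beatenValue F v * effProb p F t := by gcongr

lemma measurable_eqBid : Measurable (eqBid p F) :=
  (measurable_beatenValue.const_mul p).div measurable_effProb

/-- No bid yields more than the efficient rent: the bid `b` wins with at most the efficient
probability of the highest type `sSup S` that bids no more than `b`, and a type in `S` is not worth
mimicking. -/
lemma mul_winProb_eqBid_le (hp0 : 0 < p) (hp1 : p ≤ 1) (hF : IsSpread F vbar) {v b : ℝ}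
    (hv : 0 ≤ v) (hb : 0 ≤ b) : (v - b) * winProb p F (eqBid p F) b ≤ effRent p F v := by
  have := hF.noAtoms
  rcases le_total v b with hvb | hvb
  · exact (mul_nonpos_of_nonpos_of_nonneg (sub_nonpos.2 hvb)
      (winProb_nonneg hp0 hp1 _ _)).trans (effRent_nonneg hp0 hp1 hv)
  set S : Set ℝ := {t | t ∈ Set.Icc 0 vbar ∧ eqBid p F t ≤ b} with hS
  have hne : S.Nonempty := ⟨0, ⟨le_rfl, hF.pos.le⟩, (eqBid_zero hF).trans_le hb⟩
  have hbdd : BddAbove S := ⟨vbar, fun t ht => ht.1.2⟩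
  have hwin : winProb p F (eqBid p F) b ≤ effProb p F (sSup S) := by
    have h1 : ∫ w, share b (eqBid p F w) ∂F ≤ ∫ w, share (sSup S) w ∂F := by
      refine integral_mono_ae (integrable_share measurable_const measurable_eqBid)
        (integrable_share_left F _) ?_
      filter_upwards [hF.ae_mem, Measure.ae_ne F (sSup S)] with w hw hne
      rcases le_or_gt (eqBid p F w) b with h | h
      · have : w ≤ sSup S := le_csSup hbdd ⟨Set.Ioo_subset_Icc_self hw, h⟩
        rw [share_of_lt (this.lt_of_ne hne)]
        exact share_le_one _ _
      · rw [share_of_gt h]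
        exact share_nonneg _ _
    have h2 := share_le_one b 0
    unfold winProb effProb
    nlinarith
  have hle : ∀ t ∈ S, (v - b) * effProb p F t ≤ effRent p F v := by
    intro t ht
    have h1 := le_effRent hp0 hF t v
    have h2 := eqBid_mul_effProb hp0 hp1 hF ht.1
    have h3 := mul_le_mul_of_nonneg_right ht.2 (effProb_nonneg (F := F) hp0 hp1 t)
    linarith
  have hclosed : IsClosed {t | (v - b) * effProb p F t ≤ effRent p F v} :=
    isClosed_le (continuous_const.mul (continuous_effProb hF)) continuous_const
  have hsup : (v - b) * effProb p F (sSup S) ≤ effRent p F v :=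
    closure_minimal hle hclosed (csSup_mem_closure hne hbdd)
  exact (mul_le_mul_of_nonneg_left hwin (sub_nonneg.2 hvb)).trans hsup

lemma isBestReply_eqBid (hp0 : 0 < p) (hp1 : p ≤ 1) (hF : IsSpread F vbar) :
    IsBestReply p F vbar (eqBid p F) (eqBid p F) := by
  have := hF.noAtoms
  refine fun v hv => ⟨eqBid_nonneg hp0 hp1 hF v, fun b hb => ?_⟩
  refine (mul_winProb_eqBid_le hp0 hp1 hF hv.1 hb).trans ?_
  rw [effRent_eq hF, ← eqBid_mul_effProb hp0 hp1 hF hv, ← sub_mul]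
  rcases hv.1.lt_or_eq with h | rfl
  swap
  · simp [eqBid_zero hF]
  have hv' : v ∈ Set.Ioc 0 vbar := ⟨h, hv.2⟩
  have hpos : 0 < eqBid p F v := by
    refine (eqBid_nonneg hp0 hp1 hF (v / 2)).trans_lt ?_
    exact eqBid_strictMono hp0 hp1 hF (half_pos h) (half_lt_self h) hv.2
  have hlt : 0 ≤ v - eqBid p F v := by
    have a := effRent_pos hp0 hp1 hF hv'
    rw [effRent_eq hF, ← eqBid_mul_effProb hp0 hp1 hF hv, ← sub_mul] at a
    exact ((pos_iff_pos_of_mul_pos a).2 (effProb_pos hp0 hp1 hF hv')).le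
  refine mul_le_mul_of_nonneg_left ?_ hlt
  have : ∫ w, share v w ∂F ≤ ∫ w, share (eqBid p F v) (eqBid p F w) ∂F := by
    refine integral_mono_ae (integrable_share_left F v)
      (integrable_share measurable_const measurable_eqBid) ?_
    filter_upwards [hF.ae_mem, Measure.ae_ne F v] with w hw hne
    rcases hne.lt_or_gt with h' | h'
    · rw [share_of_lt (eqBid_strictMono hp0 hp1 hF hw.1 h' hv.2)]
      exact share_le_one _ _
    · rw [share_of_gt h']
      exact share_nonneg _ _
  unfold effProb winProb
  rw [share_of_lt hpos]
  nlinarith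

lemma integral_beatenValue_pos (hF : IsSpread F vbar) : 0 < ∫ v, beatenValue F v ∂F := by
  have hi : Integrable (beatenValue F) F := by
    refine Integrable.of_bound measurable_beatenValue.aestronglyMeasurable vbar ?_
    refine .of_forall fun v => ?_
    rw [Real.norm_of_nonneg (beatenValue_nonneg hF v)]
    have : beatenValue F v ≤ ∫ _, vbar ∂F := by
      refine integral_mono_ae (integrable_share_mul_id hF v) (integrable_const _) ?_
      filter_upwards [hF.ae_mem] with w hw
      nlinarith [share_le_one v w, hw.1, hw.2]
    simpa using this
  refine (integral_nonneg (beatenValue_nonneg hF)).lt_of_ne' fun h0 => ?_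
  rw [integral_eq_zero_iff_of_nonneg (beatenValue_nonneg hF) hi] at h0
  obtain ⟨v, hv, h0⟩ := hF.exists_mem_of_ae h0 le_rfl hF.pos le_rfl
  have h1 : ∫ w, share v w * w ∂F = 0 := h0
  rw [integral_eq_zero_iff_of_nonneg_ae
    (by filter_upwards [hF.ae_mem] with w hw using mul_nonneg (share_nonneg _ _) hw.1.le)
    (integrable_share_mul_id hF v)] at h1
  obtain ⟨w, hw, h1⟩ := hF.exists_mem_of_ae h1 le_rfl hv.1 hv.2.le
  simp [share_of_lt hw.2, hw.1.ne'] at h1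

end Core

/-! ### Regular distributions -/

lemma IsRegularDistribution.isSpread {F : Measure ℝ} {vbar : ℝ}
    (hF : IsRegularDistribution F vbar) : IsSpread F vbar := by
  obtain ⟨hpos, f, hf, hf0, rfl, -⟩ := hF
  have hac := withDensity_absolutelyContinuous (volume.restrict (Set.Icc 0 vbar))
    (fun v => ENNReal.ofReal (f v))
  have hnull : NullSingletonClass ((volume.restrict (Set.Icc 0 vbar)).withDensity
      (fun v => ENNReal.ofReal (f v))) := ⟨fun x => hac (measure_singleton x)⟩
  refine ⟨hpos, hnull, ?_, fun a c ha hac' hc => ?_⟩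
  · filter_upwards [hac.ae_le (ae_restrict_mem measurableSet_Icc), Measure.ae_ne _ 0,
      Measure.ae_ne _ vbar] with v hv h0 h1
    exact ⟨hv.1.lt_of_ne' h0, hv.2.lt_of_ne h1⟩
  · refine pos_iff_ne_zero.2 fun h => ?_
    rw [withDensity_apply_eq_zero hf.ennreal_ofReal] at h
    have hsub : Set.Ioo a c ⊆ {x | ENNReal.ofReal (f x) ≠ 0} ∩ Set.Ioo a c := fun x hx =>
      ⟨(ENNReal.ofReal_pos.2 (hf0 x ⟨ha.trans_lt hx.1, hx.2.trans_le hc⟩)).ne', hx⟩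
    have h' := measure_mono_null hsub h
    rw [Measure.restrict_apply measurableSet_Ioo, Set.inter_eq_left.2
      (Set.Ioo_subset_Icc_self.trans (Set.Icc_subset_Icc ha hc)), Real.volume_Ioo] at h'
    exact hac'.not_ge (by simpa using h')

/-! ### The joint law of types and conversation -/

lemma one_sub_ne (i : Fin 2) : 1 - i ≠ i := by fin_cases i <;> decide

lemma one_sub_one_sub (i : Fin 2) : 1 - (1 - i) = i := by fin_cases i <;> decide

lemma UserType.quality_nonneg (θ : UserType) (i : Fin 2) : 0 ≤ θ.quality i := by
  unfold UserType.quality; split_ifs <;> norm_num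

lemma UserType.quality_le_one (θ : UserType) (i : Fin 2) : θ.quality i ≤ 1 := by
  unfold UserType.quality; split_ifs <;> norm_num

/-- The coordinates of a pair of independent copies, read from the viewpoint of `i`. -/
lemma measurePreserving_own_other {X : Type*} [MeasurableSpace X] (Q : Measure X)
    [IsProbabilityMeasure Q] (i : Fin 2) :
    MeasurePreserving (fun x : Fin 2 → X => (x i, x (1 - i))) (Measure.pi fun _ => Q)
      (Q.prod Q) := by
  fin_cases i
  · exact measurePreserving_finTwoArrow Q
  · exact Measure.measurePreserving_swap.comp (measurePreserving_finTwoArrow Q)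

namespace Conversation

variable {Ω : Type*} [MeasurableSpace Ω] (M : Conversation Ω)

instance : IsProbabilityMeasure M.prior := by unfold prior; infer_instance

instance : IsProbabilityMeasure M.joint := by unfold joint; infer_instance

lemma measurable_quality (i : Fin 2) :
    Measurable fun s : UserType × Ω => s.1.quality i :=
  (measurable_of_countable fun θ : UserType => θ.quality i).comp measurable_fst

lemma integrable_quality (i : Fin 2) :
    Integrable (fun s : UserType × Ω => s.1.quality i) M.joint :=
  Integrable.of_bound (measurable_quality i).aestronglyMeasurable 1
    (.of_forall fun s => by
      rw [Real.norm_of_nonneg (s.1.quality_nonneg i)]; exact s.1.quality_le_one i)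

lemma integral_own_mul_other (i : Fin 2) (f g : Bool → ℝ) :
    ∫ s, f (s.1 i) * g (s.1 (1 - i)) ∂M.joint =
      (M.p * f true + (1 - M.p) * f false) * (M.p * g true + (1 - M.p) * g false) := by
  have h1 : MeasurePreserving (Prod.fst : UserType × Ω → UserType) M.joint M.prior :=
    ⟨measurable_fst, Measure.fst_compProd _ _⟩
  have h2 := (measurePreserving_own_other (bernoulliMeasure true false M.p) i).comp h1
  have h := integral_map (μ := M.joint) h2.measurable.aemeasurable
    (f := fun x : Bool × Bool => f x.1 * g x.2)
    (measurable_of_countable _).aestronglyMeasurable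
  rw [h2.map_eq, integral_prod_mul, integral_bernoulliMeasure, integral_bernoulliMeasure] at h
  simpa using h.symm

lemma integral_quality (i : Fin 2) : ∫ s, s.1.quality i ∂M.joint = M.p := by
  have := M.integral_own_mul_other i (fun b => if b then 1 else 0) (fun _ => 1)
  simpa [UserType.quality] using this

/-- Averaging over the types, and over independent data `y`, a payoff that advertiser `i` gets only
when his ad is good and that depends on the quality of the other ad. -/
lemma integral_quality_mul {Y : Type*} [MeasurableSpace Y] (ν : Measure Y) [IsProbabilityMeasure ν]
    (i : Fin 2) {g : Bool → Y → ℝ} (hg : ∀ c, Integrable (g c) ν) :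
    Integrable (fun x : (UserType × Ω) × Y => x.1.1.quality i * g (x.1.1 (1 - i)) x.2)
      (M.joint.prod ν) ∧
    ∫ x : (UserType × Ω) × Y, x.1.1.quality i * g (x.1.1 (1 - i)) x.2 ∂(M.joint.prod ν) =
      M.p * (M.p * ∫ y, g true y ∂ν + (1 - M.p) * ∫ y, g false y ∂ν) := by
  have hq := M.integrable_quality
  have e : (fun x : (UserType × Ω) × Y => x.1.1.quality i * g (x.1.1 (1 - i)) x.2) =
      fun x => (x.1.1.quality i * x.1.1.quality (1 - i)) * g true x.2 +
        (x.1.1.quality i * (1 - x.1.1.quality (1 - i))) * g false x.2 := by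
    funext x
    unfold UserType.quality
    cases x.1.1 (1 - i) <;> simp
  have b : ∀ j, ∀ᵐ s ∂M.joint, ‖s.1.quality j‖ ≤ 1 := fun j => .of_forall fun s => by
    rw [Real.norm_of_nonneg (s.1.quality_nonneg j)]; exact s.1.quality_le_one j
  have i1 := ((hq (1 - i)).bdd_mul (hq i).aestronglyMeasurable (b i)).mul_prod (hg true)
  have h1 : Integrable (fun s : UserType × Ω => 1 - s.1.quality (1 - i)) M.joint :=
    (integrable_const 1).sub (hq (1 - i))
  have i2 := (h1.bdd_mul (hq i).aestronglyMeasurable (b i)).mul_prod (hg false)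
  have e1 : ∫ s, s.1.quality i * s.1.quality (1 - i) ∂M.joint = M.p * M.p := by
    simpa [UserType.quality] using M.integral_own_mul_other i (fun b => if b then 1 else 0)
      (fun b => if b then 1 else 0)
  have e2 : ∫ s, s.1.quality i * (1 - s.1.quality (1 - i)) ∂M.joint = M.p * (1 - M.p) := by
    simpa [UserType.quality] using M.integral_own_mul_other i (fun b => if b then 1 else 0)
      (fun b => 1 - if b then 1 else 0)
  rw [e]
  refine ⟨i1.add i2, ?_⟩
  rw [integral_add i1 i2,
    integral_prod_mul (fun s : UserType × Ω => s.1.quality i * s.1.quality (1 - i)) (g true),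
    integral_prod_mul (fun s : UserType × Ω => s.1.quality i * (1 - s.1.quality (1 - i)))
      (g false), e1, e2]
  ring

/-! ### Beliefs -/

variable {M}

lemma belief_nonneg (τ : M.StopTime) (i : Fin 2) : ∀ᵐ s ∂M.joint, 0 ≤ M.belief τ i s :=
  condExp_nonneg (.of_forall fun s => s.1.quality_nonneg i)

lemma stronglyMeasurable_belief (τ : M.StopTime) (i : Fin 2) :
    StronglyMeasurable[τ.2.measurableSpace] (M.belief τ i) :=
  stronglyMeasurable_condExp

lemma measurable_belief (τ : M.StopTime) (i : Fin 2) : Measurable (M.belief τ i) :=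
  ((stronglyMeasurable_belief τ i).mono τ.2.measurableSpace_le).measurable

/-- Once the whole conversation is observed, the type is known. -/
lemma belief_stopAtInfinity (hid : M.Identifiable) (i : Fin 2) :
    M.belief M.stopAtInfinity i =ᵐ[M.joint] fun s => s.1.quality i := by
  obtain ⟨g, hg, hae⟩ := hid
  have hle : (⨆ t, MeasurableSpace.comap (M.X t) inferInstance) ≤ ‹MeasurableSpace Ω› :=
    iSup_le fun t => (M.measurable_X t).comap_le
  have hg' : Measurable g := hg.mono hle le_rfl
  have hrec : ∀ᵐ s ∂M.joint, g s.2 = s.1 :=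
    Measure.ae_compProd_of_ae_ae
      (measurableSet_eq_fun (hg'.comp measurable_snd) measurable_fst) (.of_forall hae)
  have hsup : (⨆ t, MeasurableSpace.comap (M.X t) inferInstance).comap
      (Prod.snd : UserType × Ω → Ω) ≤ ⨆ t, M.filtration t := by
    rw [MeasurableSpace.comap_iSup]
    refine iSup_mono fun t => ?_
    rw [MeasurableSpace.comap_comp]
    exact le_iSup₂_of_le (f := fun j (_ : j ≤ t) => MeasurableSpace.comap
      (fun s : UserType × Ω => M.X j s.2) inferInstance) t le_rfl le_rfl
  have hm : (⨆ t, M.filtration t) ≤ M.stopAtInfinity.2.measurableSpace := fun s hs =>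
    ⟨hs, fun t => by
      have : {ω | M.stopAtInfinity.1 ω ≤ (t : WithTop ℝ≥0)} = ∅ :=
        Set.eq_empty_of_forall_notMem fun _ h =>
          WithTop.coe_ne_top (a := t) (top_le_iff.1 (h : (⊤ : WithTop ℝ≥0) ≤ t))
      change MeasurableSet[M.filtration t] (s ∩ {ω | M.stopAtInfinity.1 ω ≤ (t : WithTop ℝ≥0)})
      rw [this, Set.inter_empty]
      exact @MeasurableSet.empty _ (M.filtration t)⟩
  have hmeas : Measurable[M.stopAtInfinity.2.measurableSpace] fun s : UserType × Ω => g s.2 :=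
    (hg.comp (comap_measurable (m := ⨆ t, MeasurableSpace.comap (M.X t) inferInstance)
      Prod.snd)).mono (hsup.trans hm) le_rfl
  refine condExp_of_aestronglyMeasurable' M.stopAtInfinity.2.measurableSpace_le ?_
    (M.integrable_quality i)
  refine ⟨fun s => (g s.2).quality i, ?_, ?_⟩
  · exact ((measurable_of_countable fun θ : UserType => θ.quality i).comp
      hmeas).stronglyMeasurable
  · filter_upwards [hrec] with s hs
    rw [hs]

/-- Pulling a bounded factor known at time `τ` out of the conditional expectation. -/
lemma integral_mul_quality (τ : M.StopTime) (i : Fin 2) {D : UserType × Ω → ℝ} {c : ℝ}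
    (hD : StronglyMeasurable[τ.2.measurableSpace] D) (hb : ∀ᵐ s ∂M.joint, ‖D s‖ ≤ c) :
    ∫ s, D s * s.1.quality i ∂M.joint = ∫ s, D s * M.belief τ i s ∂M.joint := by
  rw [← integral_condExp τ.2.measurableSpace_le]
  exact integral_congr_ae (condExp_stronglyMeasurable_mul_of_bound τ.2.measurableSpace_le hD
    (M.integrable_quality i) c hb)

lemma integral_belief (τ : M.StopTime) (i : Fin 2) : ∫ s, M.belief τ i s ∂M.joint = M.p := by
  unfold belief
  rw [integral_condExp τ.2.measurableSpace_le, M.integral_quality]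

lemma display_eq (b : Fin 2 → ℝ) (τ : M.StopTime) (i : Fin 2) (s : UserType × Ω) :
    M.display b τ i s =
      share (b i * M.belief τ i s) (b (1 - i) * M.belief τ (1 - i) s) := rfl

/-! ### The second-price auction -/

lemma ae_revenueAt_stopNow (hp : 0 < (M.p : ℝ)) (hstart : M.StartsAtPrior) :
    ∀ᵐ s ∂M.joint, ∀ b, M.revenueAt .secondPrice b M.stopNow s =
      ∑ i, s.1.quality i * (share (b i) (b (1 - i)) * b (1 - i)) := by
  filter_upwards [ae_all_iff.2 hstart] with s hs b
  refine Finset.sum_congr rfl fun i _ => ?_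
  simp only [display_eq, pricePerClick, hs, share_mul_right hp]
  field_simp

lemma ae_payoffAt_stopNow (hp : 0 < (M.p : ℝ)) (hstart : M.StartsAtPrior) :
    ∀ᵐ s ∂M.joint, ∀ b i v, M.payoffAt .secondPrice b M.stopNow i v s =
      s.1.quality i * (share (b i) (b (1 - i)) * (v - b (1 - i))) := by
  filter_upwards [ae_all_iff.2 hstart] with s hs b i v
  simp only [payoffAt, display_eq, pricePerClick, hs, share_mul_right hp]
  field_simp

lemma integral_revenueAt_stopNow (hp : 0 < (M.p : ℝ)) (hstart : M.StartsAtPrior)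
    (b : Fin 2 → ℝ) :
    ∫ s, M.revenueAt .secondPrice b M.stopNow s ∂M.joint = M.p * min (b 0) (b 1) := by
  rw [integral_congr_ae ((ae_revenueAt_stopNow hp hstart).mono fun s hs => hs b),
    integral_finsetSum _ fun i _ => (M.integrable_quality i).mul_const _]
  simp only [integral_mul_const, M.integral_quality, Fin.sum_univ_two]
  rw [← mul_share_add_swap_eq_min]
  simp
  ring

/-- The expected revenue at time `τ` is at most the expectation of the lower score `b_i μ^i_τ`,
by pulling the price out of the conditional expectation; and the scores are martingales. -/
lemma isOptimalPolicy_immediate (hp : 0 < (M.p : ℝ)) (hstart : M.StartsAtPrior) :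
    M.IsOptimalPolicy .secondPrice M.immediate := by
  intro b hb τ
  rw [immediate, integral_revenueAt_stopNow hp hstart]
  set μ := M.belief τ with hμ
  set D : Fin 2 → UserType × Ω → ℝ := fun i s =>
    M.display b τ i s * pricePerClick .secondPrice b (fun j => μ j s) i with hD
  have hnn : ∀ᵐ s ∂M.joint, ∀ i, 0 ≤ μ i s := ae_all_iff.2 fun i => belief_nonneg τ i
  have hDm : ∀ i, StronglyMeasurable[τ.2.measurableSpace] (D i) := by
    intro i
    have h := fun j => (stronglyMeasurable_belief τ j).measurable
    exact ((((h i).const_mul _).share ((h (1 - i)).const_mul _)).mul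
      (((h (1 - i)).const_mul _).div (h i))).stronglyMeasurable
  -- whoever is displayed pays at most his bid; with `μ i s = 0` the price is the junk value `0`
  have hDb : ∀ i, ∀ᵐ s ∂M.joint, ‖D i s‖ ≤ b i := by
    intro i
    filter_upwards [hnn] with s hs
    have hprice : 0 ≤ b (1 - i) * μ (1 - i) s / μ i s :=
      div_nonneg (mul_nonneg (hb _) (hs _)) (hs _)
    simp only [hD, display_eq, pricePerClick]
    rw [Real.norm_of_nonneg (mul_nonneg (share_nonneg _ _) hprice)]
    rcases (hs i).lt_or_eq with h | h
    · rcases le_or_gt (b (1 - i) * μ (1 - i) s) (b i * μ i s) with h' | h'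
      · have := (div_le_iff₀ h).2 h'
        nlinarith [share_le_one (b i * μ i s) (b (1 - i) * μ (1 - i) s)]
      · rw [share_of_gt h', zero_mul]
        exact hb i
    · rw [← h, div_zero, mul_zero]
      exact hb i
  have hmeas : ∀ i, AEStronglyMeasurable (D i) M.joint := fun i =>
    ((hDm i).mono τ.2.measurableSpace_le).aestronglyMeasurable
  have hμi : ∀ i, Integrable (μ i) M.joint := fun i => integrable_condExp
  have hint : ∀ i, Integrable (fun s => D i s * μ i s) M.joint := fun i =>
    (hμi i).bdd_mul (hmeas i) (hDb i)
  have e : ∫ s, M.revenueAt .secondPrice b τ s ∂M.joint = ∫ s, ∑ i, D i s * μ i s ∂M.joint := by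
    have : ∀ s, M.revenueAt .secondPrice b τ s = ∑ i, D i s * s.1.quality i := fun s =>
      Finset.sum_congr rfl fun i _ => by simp only [hD]; ring
    simp only [this]
    rw [integral_finsetSum _ fun i _ => (M.integrable_quality i).bdd_mul (hmeas i) (hDb i),
      integral_finsetSum _ fun i _ => hint i]
    exact Finset.sum_congr rfl fun i _ => integral_mul_quality τ i (hDm i) (hDb i)
  have hle : ∀ᵐ s ∂M.joint, ∑ i, D i s * μ i s ≤ min (b 0 * μ 0 s) (b 1 * μ 1 s) := by
    filter_upwards [hnn] with s hs
    have hterm : ∀ i, D i s * μ i s ≤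
        share (b i * μ i s) (b (1 - i) * μ (1 - i) s) * (b (1 - i) * μ (1 - i) s) := by
      intro i
      simp only [hD, display_eq, pricePerClick]
      rcases (hs i).lt_or_eq with h | h
      · rw [mul_assoc, div_mul_cancel₀ _ h.ne']
      · rw [← hμ, ← h, mul_zero]
        exact mul_nonneg (share_nonneg _ _) (mul_nonneg (hb _) (hs _))
    rw [Fin.sum_univ_two, ← mul_share_add_swap_eq_min]
    exact add_le_add (hterm 0) (hterm 1)
  have hI : ∀ i, ∫ s, b i * μ i s ∂M.joint = M.p * b i := fun i => by
    rw [integral_const_mul, integral_belief, mul_comm]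
  rw [e, mul_min_of_nonneg _ _ hp.le]
  have hs : Integrable (fun s => ∑ i, D i s * μ i s) M.joint :=
    integrable_finsetSum _ fun i _ => hint i
  refine le_min ?_ ?_
  · rw [← hI 0]
    exact integral_mono_ae hs ((hμi 0).const_mul _)
      (hle.mono fun s h => h.trans (min_le_left _ _))
  · rw [← hI 1]
    exact integral_mono_ae hs ((hμi 1).const_mul _)
      (hle.mono fun s h => h.trans (min_le_right _ _))

lemma isTruthful_immediate (hp : 0 < (M.p : ℝ)) (hstart : M.StartsAtPrior) (vbar : ℝ) :
    M.IsTruthful .secondPrice M.immediate vbar := by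
  intro i v _ c _
  have e : ∀ b, ∫ s, M.payoffAt .secondPrice b M.stopNow i v s ∂M.joint =
      M.p * (share (b i) (b (1 - i)) * (v - b (1 - i))) := fun b => by
    rw [integral_congr_ae ((ae_payoffAt_stopNow hp hstart).mono fun s hs => hs b i v),
      integral_mul_const, M.integral_quality]
  simp only [immediate, e, Function.update_self, Function.update_of_ne (one_sub_ne i)]
  exact mul_le_mul_of_nonneg_left (share_mul_sub_le _ _ _) hp.le

lemma expectedRevenue_secondPrice (hp : 0 < (M.p : ℝ)) (hstart : M.StartsAtPrior)
    {F : Measure ℝ} [IsProbabilityMeasure F] {vbar : ℝ} (hF : IsSpread F vbar) :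
    M.expectedRevenue .secondPrice M.immediate F (fun _ v => v) =
      2 * (M.p * ∫ v, beatenValue F v ∂F) := by
  have hint : Integrable (fun x : ℝ × ℝ => share x.1 x.2 * x.2) (F.prod F) := by
    refine Integrable.of_bound (measurable_share.mul measurable_snd).aestronglyMeasurable vbar ?_
    filter_upwards [Measure.quasiMeasurePreserving_snd.ae hF.ae_mem] with x hx
    rw [Real.norm_of_nonneg (mul_nonneg (share_nonneg _ _) hx.1.le)]
    nlinarith [share_le_one x.1 x.2, hx.1, hx.2]
  have hpi := fun i => (measurePreserving_own_other F i).integrable_comp_of_integrable hint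
  have hI : ∀ i : Fin 2, ∫ y : Fin 2 → ℝ, share (y i) (y (1 - i)) * y (1 - i)
      ∂(Measure.pi fun _ => F) = ∫ v, beatenValue F v ∂F := fun i => by
    have h := integral_map (μ := Measure.pi fun _ : Fin 2 => F)
      (measurePreserving_own_other F i).measurable.aemeasurable
      (f := fun x : ℝ × ℝ => share x.1 x.2 * x.2)
      (measurable_share.mul measurable_snd).aestronglyMeasurable
    rw [(measurePreserving_own_other F i).map_eq, integral_prod _ hint] at h
    exact h.symm
  have hq := fun i => M.integral_quality_mul (Measure.pi fun _ : Fin 2 => F) i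
    (g := fun _ y => share (y i) (y (1 - i)) * y (1 - i)) (fun _ => hpi i)
  have hae : ∀ᵐ x ∂(M.joint.prod (Measure.pi fun _ : Fin 2 => F)),
      M.revenueAt .secondPrice x.2 M.stopNow x.1 =
        ∑ i, x.1.1.quality i * (share (x.2 i) (x.2 (1 - i)) * x.2 (1 - i)) := by
    filter_upwards [Measure.quasiMeasurePreserving_fst.ae (ae_revenueAt_stopNow hp hstart)]
      with x hx using hx _
  unfold expectedRevenue immediate
  rw [integral_congr_ae hae, integral_finsetSum _ fun i _ => (hq i).1, Fin.sum_univ_two,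
    (hq 0).2, (hq 1).2, hI, hI]
  ring

/-! ### The first-price auction -/

/-- The revenue of the first-price auction is at most `max (b_i θ_i)`, and equals it when the
beliefs are exact. -/
lemma isOptimalPolicy_delayed (hid : M.Identifiable) :
    M.IsOptimalPolicy .firstPrice M.delayed := by
  intro b hb τ
  have hmeas : ∀ σ : M.StopTime, Measurable (M.revenueAt .firstPrice b σ) := fun σ => by
    refine Finset.measurable_fun_sum _ fun i _ => ?_
    have h := measurable_belief σ
    exact ((((h i).const_mul _).share ((h (1 - i)).const_mul _)).mul
      (measurable_quality i)).mul_const _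
  have hform : ∀ σ s, M.revenueAt .firstPrice b σ s =
      M.display b σ 0 s * (b 0 * s.1.quality 0) + M.display b σ 1 s * (b 1 * s.1.quality 1) := by
    intro σ s
    simp only [revenueAt, pricePerClick, Fin.sum_univ_two]
    ring
  have hsum : ∀ σ s, M.display b σ 0 s + M.display b σ 1 s = 1 := fun σ s =>
    share_add_swap _ _
  have hd0 : ∀ σ i s, 0 ≤ M.display b σ i s := fun σ i s => share_nonneg _ _
  have hbq : ∀ i (s : UserType × Ω), 0 ≤ b i * s.1.quality i ∧ b i * s.1.quality i ≤ b i :=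
    fun i s => ⟨mul_nonneg (hb i) (s.1.quality_nonneg i),
      mul_le_of_le_one_right (hb i) (s.1.quality_le_one i)⟩
  have hmax : ∀ σ s, M.revenueAt .firstPrice b σ s ≤
      max (b 0 * s.1.quality 0) (b 1 * s.1.quality 1) := by
    intro σ s
    rw [hform]
    exact (add_le_add (mul_le_mul_of_nonneg_left (le_max_left _ _) (hd0 σ 0 s))
      (mul_le_mul_of_nonneg_left (le_max_right _ _) (hd0 σ 1 s))).trans_eq
        (by rw [← add_mul, hsum, one_mul])
  have hint : ∀ σ : M.StopTime, Integrable (M.revenueAt .firstPrice b σ) M.joint := fun σ => by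
    refine Integrable.of_bound (hmeas σ).aestronglyMeasurable (max (b 0) (b 1))
      (.of_forall fun s => ?_)
    rw [Real.norm_of_nonneg]
    · exact (hmax σ s).trans (max_le_max (hbq 0 s).2 (hbq 1 s).2)
    · rw [hform]
      exact add_nonneg (mul_nonneg (hd0 _ _ _) (hbq 0 s).1) (mul_nonneg (hd0 _ _ _) (hbq 1 s).1)
  refine integral_mono_ae (hint τ) (hint _) ?_
  filter_upwards [belief_stopAtInfinity hid 0, belief_stopAtInfinity hid 1] with s h0 h1
  refine (hmax τ s).trans_eq ?_
  have e0 : M.display b M.stopAtInfinity 0 s =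
      share (b 0 * s.1.quality 0) (b 1 * s.1.quality 1) := by
    rw [← h0, ← h1]; rfl
  have e1 : M.display b M.stopAtInfinity 1 s =
      share (b 1 * s.1.quality 1) (b 0 * s.1.quality 0) := by
    rw [← h0, ← h1]; rfl
  rw [delayed, hform, e0, e1, mul_share_add_swap_eq_max]

/-- With exact beliefs, an ad is displayed to a click only against the bid of the opponent, which
counts as `0` if the opponent's ad is bad. -/
lemma ae_display_stopAtInfinity (hid : M.Identifiable) :
    ∀ᵐ s ∂M.joint, ∀ b i, M.display b M.stopAtInfinity i s * s.1.quality i =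
      s.1.quality i * share (b i) (if s.1 (1 - i) then b (1 - i) else 0) := by
  filter_upwards [ae_all_iff.2 fun i => belief_stopAtInfinity hid i] with s hs b i
  rw [display_eq, hs, hs]
  unfold UserType.quality
  cases s.1 i <;> cases s.1 (1 - i) <;> simp

lemma interimPayoff_firstPrice (hid : M.Identifiable) {F : Measure ℝ} [IsProbabilityMeasure F]
    {β : Fin 2 → ℝ → ℝ} (hβ : ∀ i, Measurable (β i)) (i : Fin 2) (v b : ℝ) :
    M.interimPayoff .firstPrice M.delayed F β i v b =
      M.p * ((v - b) * winProb M.p F (β (1 - i)) b) := by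
  have hi : ∀ c : Bool, Integrable
      (fun w => share b (if c then β (1 - i) w else 0) * (v - b)) F := by
    intro c
    refine (integrable_share measurable_const ?_).mul_const _
    cases c <;> simp [hβ]
  have hae : ∀ᵐ x ∂(M.joint.prod F),
      M.payoffAt .firstPrice (bidsAgainst β i b x.2) M.stopAtInfinity i v x.1 =
        x.1.1.quality i * (share b (if x.1.1 (1 - i) then β (1 - i) x.2 else 0) * (v - b)) := by
    filter_upwards [Measure.quasiMeasurePreserving_fst.ae (ae_display_stopAtInfinity hid)] with x hx
    have e1 : bidsAgainst β i b x.2 i = b := Function.update_self _ _ _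
    have e2 : bidsAgainst β i b x.2 (1 - i) = β (1 - i) x.2 :=
      Function.update_of_ne (one_sub_ne i) _ _
    simp only [payoffAt, hx, pricePerClick, e1, e2]
    ring
  unfold interimPayoff delayed
  rw [integral_congr_ae hae, (M.integral_quality_mul F i hi).2]
  simp only [integral_mul_const, winProb, if_true, Bool.false_eq_true, if_false, integral_const,
    probReal_univ, smul_eq_mul, one_mul]
  ring

lemma isEquilibrium_iff (hp : 0 < (M.p : ℝ)) (hid : M.Identifiable) {F : Measure ℝ}
    [IsProbabilityMeasure F] {vbar : ℝ} {β : Fin 2 → ℝ → ℝ} :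
    M.IsEquilibrium .firstPrice M.delayed F vbar β ↔
      (∀ i, Measurable (β i)) ∧ ∀ i, IsBestReply M.p F vbar (β i) (β (1 - i)) := by
  unfold IsEquilibrium IsBestReply
  refine and_congr_right fun hβ => ?_
  simp only [interimPayoff_firstPrice hid hβ, mul_le_mul_iff_right₀ hp]
  exact ⟨fun h i v hv => ⟨h.1 i v hv, h.2 i v hv⟩,
    fun h => ⟨fun i v hv => (h i v hv).1, fun i v hv => (h i v hv).2⟩⟩

lemma expectedRevenue_firstPrice (hp : 0 < (M.p : ℝ)) (hid : M.Identifiable) {F : Measure ℝ}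
    [IsProbabilityMeasure F] {vbar : ℝ} (hF : IsSpread F vbar) {β : Fin 2 → ℝ → ℝ}
    (h : M.IsEquilibrium .firstPrice M.delayed F vbar β) :
    M.expectedRevenue .firstPrice M.delayed F β =
      2 * (M.p * (M.p * ∫ v, beatenValue F v ∂F)) := by
  obtain ⟨hβ, hbr⟩ := (isEquilibrium_iff hp hid).1 h
  have hbr' : ∀ i, IsBestReply M.p F vbar (β (1 - i)) (β i) := fun i => by
    simpa [one_sub_one_sub] using hbr (1 - i)
  have hp1 : (M.p : ℝ) ≤ 1 := M.p.2.2
  have hmeas : ∀ i (c : Bool), Measurable fun x : ℝ × ℝ =>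
      share (β i x.1) (if c then β (1 - i) x.2 else 0) * β i x.1 := by
    intro i c
    refine Measurable.mul (Measurable.share ((hβ i).comp measurable_fst) ?_)
      ((hβ i).comp measurable_fst)
    cases c
    · simp
    · exact (hβ (1 - i)).comp measurable_snd
  have hint : ∀ i (c : Bool), Integrable (fun x : ℝ × ℝ =>
      share (β i x.1) (if c then β (1 - i) x.2 else 0) * β i x.1) (F.prod F) := by
    intro i c
    refine Integrable.of_bound (hmeas i c).aestronglyMeasurable vbar ?_
    filter_upwards [Measure.quasiMeasurePreserving_fst.ae hF.ae_mem] with x hx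
    obtain ⟨-, h0, h1⟩ := (hbr i).bounds hp hp1 hF (hβ i) (hβ _) (hbr' i)
      (Set.Ioo_subset_Ioc_self hx)
    rw [Real.norm_of_nonneg (mul_nonneg (share_nonneg _ _) h0.le)]
    nlinarith [share_le_one (β i x.1) (if c then β (1 - i) x.2 else 0), hx.2]
  have hpi := fun i c => (measurePreserving_own_other F i).integrable_comp_of_integrable (hint i c)
  have hI : ∀ i (c : Bool), ∫ y : Fin 2 → ℝ,
      share (β i (y i)) (if c then β (1 - i) (y (1 - i)) else 0) * β i (y i)
      ∂(Measure.pi fun _ => F) =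
      ∫ v, (∫ w, share (β i v) (if c then β (1 - i) w else 0) ∂F) * β i v ∂F := by
    intro i c
    have h := integral_map (μ := Measure.pi fun _ : Fin 2 => F)
      (measurePreserving_own_other F i).measurable.aemeasurable
      (hmeas i c).aestronglyMeasurable
    rw [(measurePreserving_own_other F i).map_eq, integral_prod _ (hint i c)] at h
    simp only [integral_mul_const] at h
    exact h.symm
  have hq := fun i => M.integral_quality_mul (Measure.pi fun _ : Fin 2 => F) i
    (g := fun c y => share (β i (y i)) (if c then β (1 - i) (y (1 - i)) else 0) * β i (y i))
    (fun c => hpi i c)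
  have hval : ∀ i, ∫ x : (UserType × Ω) × (Fin 2 → ℝ), x.1.1.quality i *
      (share (β i (x.2 i)) (if x.1.1 (1 - i) then β (1 - i) (x.2 (1 - i)) else 0) * β i (x.2 i))
      ∂(M.joint.prod (Measure.pi fun _ => F)) = M.p * (M.p * ∫ v, beatenValue F v ∂F) := by
    intro i
    have j := fun c => (hint i c).integral_prod_left
    simp only [integral_mul_const] at j
    rw [(hq i).2, hI, hI, ← integral_const_mul, ← integral_const_mul, ← integral_const_mul,
      ← integral_add ((j true).const_mul _) ((j false).const_mul _)]
    congr 1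
    refine integral_congr_ae ?_
    filter_upwards [hF.ae_mem] with v hv
    rw [← (hbr i).mul_winProb_eq hp hp1 hF (hβ i) (hβ _) (hbr' i) hv]
    simp [winProb]
    ring
  have hae : ∀ᵐ x ∂(M.joint.prod (Measure.pi fun _ : Fin 2 => F)),
      M.revenueAt .firstPrice (fun i => β i (x.2 i)) M.stopAtInfinity x.1 =
        ∑ i, x.1.1.quality i * (share (β i (x.2 i))
          (if x.1.1 (1 - i) then β (1 - i) (x.2 (1 - i)) else 0) * β i (x.2 i)) := by
    filter_upwards [Measure.quasiMeasurePreserving_fst.ae (ae_display_stopAtInfinity hid)] with x hx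
    refine Finset.sum_congr rfl fun i _ => ?_
    rw [hx, pricePerClick, mul_assoc]
  unfold expectedRevenue delayed
  rw [integral_congr_ae hae, integral_finsetSum _ fun i _ => (hq i).1, Fin.sum_univ_two,
    hval, hval]
  ring

end Conversation

end

theorem mainTheorem1 {Ω : Type*} [MeasurableSpace Ω] (M : Conversation Ω)
    (hp : 0 < (M.p : ℝ)) (hstart : M.StartsAtPrior) (hid : M.Identifiable)
    (F : Measure ℝ) [IsProbabilityMeasure F] (vbar : ℝ) (hF : IsRegularDistribution F vbar) :
    -- immediate exercise is optimal in the second-price auction, which is then truthful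
    M.IsOptimalPolicy .secondPrice M.immediate ∧
    M.IsTruthful .secondPrice M.immediate vbar ∧
    -- infinite delay is optimal in the first-price auction, which then has a symmetric equilibrium
    M.IsOptimalPolicy .firstPrice M.delayed ∧
    (∃ β : ℝ → ℝ, M.IsEquilibrium .firstPrice M.delayed F vbar fun _ => β) ∧
    -- revenue comparison, in every equilibrium of the first-price auction
    ∀ β : Fin 2 → ℝ → ℝ, M.IsEquilibrium .firstPrice M.delayed F vbar β →
      0 < M.expectedRevenue .firstPrice M.delayed F β ∧
      M.expectedRevenue .firstPrice M.delayed F β ≤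
        M.expectedRevenue .secondPrice M.immediate F (fun _ v => v) ∧
      M.expectedRevenue .secondPrice M.immediate F (fun _ v => v) /
        M.expectedRevenue .firstPrice M.delayed F β = 1 / (M.p : ℝ) := by
  have hS := hF.isSpread
  have hp1 : (M.p : ℝ) ≤ 1 := M.p.2.2
  refine ⟨Conversation.isOptimalPolicy_immediate hp hstart,
    Conversation.isTruthful_immediate hp hstart vbar,
    Conversation.isOptimalPolicy_delayed hid, ⟨eqBid M.p F, ?_⟩, fun β hβ => ?_⟩
  · exact (Conversation.isEquilibrium_iff hp hid).2
      ⟨fun _ => measurable_eqBid, fun _ => isBestReply_eqBid hp hp1 hS⟩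
  · rw [Conversation.expectedRevenue_firstPrice hp hid hS hβ,
      Conversation.expectedRevenue_secondPrice hp hstart hS]
    have hK := integral_beatenValue_pos hS
    have hpK := mul_pos hp hK
    refine ⟨by positivity, ?_, ?_⟩
    · have := mul_le_of_le_one_left hpK.le hp1
      linarith
    · field_simp
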